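/- All graphs are finite and simple; $|G|$ denotes the number of vertices of $G$. A \emph{blockade} in $G$ is a sequence $\mathcal{B}=(B_i : i\in I)$ of pairwise disjoint nonempty subsets of $V(G)$ (its \emph{blocks}), where $I$ is a finite set of integers; its \emph{length} is $|I|$ and its \emph{width} is $\min_{i\in I}|B_i|$. An induced subgraph $H$ of $G$ is \emph{$\mathcal{B}$-rainbow} if every vertex of $H$ belongs to some block of $\mathcal{B}$ and no two distinct vertices of $H$ belong to the same block. For $\epsilon>0$, $G$ is \emph{$\epsilon$-coherent} if $|G|>1$, every vertex of $G$ has degree less than $\epsilon|G|$, and there do not exist disjoint sets $A,B\subseteq V(G)$ with $|A|,|B|\ge \epsilon|G|$ and no edge of $G$ between $A$ and $B$. \textbf{Theorem.} For every tree $T$ there exist a real number $d>0$ and an integer $K$ such that, for every graph $G$ and every blockade $\mathcal{B}$ in $G$ of length at least $K$, if $G$ is $\frac{W}{d|G|}$-coherent, where $W$ is the width of $\mathcal{B}$, then there is a $\mathcal{B}$-rainbow induced subgraph of $G$ isomorphic to $T$. -/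

import Mathlib

namespace SimpleGraph

variable {V : Type*}

/-- `A` and `B` are anticomplete: no edge joins a vertex of `A` to a vertex of `B`.
Disjointness is asked for separately. -/
def Anticomplete (G : SimpleGraph V) (A B : Finset V) : Prop :=
  ∀ a ∈ A, ∀ b ∈ B, ¬ G.Adj a b

/-- `G` is `ε`-coherent: `ε > 0`, `G` has more than one vertex, every degree is less than
`ε |G|`, and no two disjoint anticomplete sets both have at least `ε |G|` vertices. -/
structure IsCoherent [Fintype V] (G : SimpleGraph V) [DecidableRel G.Adj] (ε : ℝ) : Prop where
  pos : 0 < ε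
  one_lt_card : 1 < Fintype.card V
  degree_lt : ∀ v : V, (G.degree v : ℝ) < ε * Fintype.card V
  not_anticomplete : ¬ ∃ A B : Finset V, Disjoint A B ∧ G.Anticomplete A B ∧
    ε * Fintype.card V ≤ (A.card : ℝ) ∧ ε * Fintype.card V ≤ (B.card : ℝ)

end SimpleGraph

/-- A blockade on the vertex set `V`: a sequence, indexed by a finite set of integers,
of pairwise disjoint nonempty finite sets of vertices. -/
structure Blockade (V : Type*) where
  index : Finset ℤ
  block : index → Finset V
  nonempty : ∀ i, (block i).Nonempty
  disjoint : ∀ i j, i ≠ j → Disjoint (block i) (block j)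

namespace Blockade

variable {V : Type*}

/-- The length: the number of blocks. -/
def length (B : Blockade V) : ℕ := B.index.card

/-- The width: the minimum size of a block (and `0` if there are no blocks). -/
noncomputable def width (B : Blockade V) : ℕ := ⨅ i : B.index, (B.block i).card

theorem width_le (B : Blockade V) (i : B.index) : B.width ≤ (B.block i).card :=
  ciInf_le (OrderBot.bddBelow _) i

theorem exists_card_eq_width (B : Blockade V) (h : 0 < B.length) :
    ∃ i : B.index, (B.block i).card = B.width := by
  obtain ⟨i, hi⟩ := Finset.card_pos.mp h
  have : Nonempty B.index := ⟨⟨i, hi⟩⟩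
  exact Nat.sInf_mem (Set.range_nonempty fun i : B.index => (B.block i).card)

/-- A set of vertices `S` (standing for the subgraph it induces) is `B`-rainbow: each vertex
of `S` is in some block, and no two distinct vertices of `S` are in the same block. -/
def IsRainbow (B : Blockade V) (S : Set V) : Prop :=
  (∀ v ∈ S, ∃ i, v ∈ B.block i) ∧
    ∀ i, ∀ u ∈ S, ∀ v ∈ S, u ∈ B.block i → v ∈ B.block i → u = v

end Blockade

/-! Every tree on at most m + 1 vertices is an induced subtree of the binomial tree of order m,
which is two copies of order m - 1 with their roots joined (`RootedTreeOn.exists_embedding`). So it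
suffices to find rainbow induced binomial trees of every order. If no d and K work, counterexamples
with d = n + 1 and K = n, viewed along a nonprincipal ultrafilter, have all degrees o(W) and an edge
between any two disjoint sets of size at least a positive multiple of W ("thick" sets).

Fix finitely many thick blocks and shrink them until no further thick shrinking destroys either of
two kinds of property (`exists_isStable`): availability (a subset of block i reaches a thick part of
block t and misses a thick part of each block in K) and aliveness (copies of a given order, rooted
in a given block, exist). By Ramsey's theorem these may be assumed to depend only on the order
pattern of the indices.

If all pairs are available in one direction, copies are built by repeated doubling
(`exists_rooted_subsystem`). Otherwise suppose order h is not reached. Let copies of order a, but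
not a + 1, exist with root in the lowest block of their index set, and likewise b for the highest
block. Place index sets E₁ < V₁ < I < V₂ < E₂, with trees of order a rooted in E₁ and otherwise in
V₁, and trees of order b rooted in E₂ and otherwise in V₂. Since nothing is available,
`IsStable.exists_contraction` finds a thick part of some block j in I, each vertex of which is
adjacent to the root of such a tree and to nothing else in it, while the tree sees nothing in thick
parts of the other blocks of I. By stability a copy inside I is rooted at one of these vertices.
Joining the two roots gives order a + 1 at the bottom or b + 1 at the top, a contradiction
(`IsStable.false_of_not_isAvailable`). -/

open Finset

-- Ramsey's theorem and finite linearly ordered sets.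

universe u in
-- Ramsey's theorem, by induction on g. `key` thins X until the colour of a (g + 1)-set depends only
-- on its least element; a pigeonhole over these elements finishes.
theorem Finset.exists_monochromatic_subset {κ : Type*} [Finite κ] (g : ℕ) :
    ∀ L : ℕ, ∃ N : ℕ, ∀ (ι : Type u) [LinearOrder ι] (c : Finset ι → κ) (X : Finset ι), N ≤ #X →
      ∃ Y ⊆ X, L ≤ #Y ∧ ∃ col, ∀ A ⊆ Y, #A = g → c A = col := by
  classical
  have := Fintype.ofFinite κ
  induction g with
  | zero =>
    intro L
    refine ⟨L, fun ι _ c X hX => ⟨X, subset_rfl, hX, c ∅, fun A _ hA => ?_⟩⟩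
    rw [card_eq_zero.1 hA]
  | succ g ih =>
    have key : ∀ L : ℕ, ∃ N : ℕ, ∀ (ι : Type u) [LinearOrder ι] (c : Finset ι → κ)
        (X : Finset ι), N ≤ #X →
        ∃ Y ⊆ X, L ≤ #Y ∧ ∃ φ : ι → κ, ∀ x ∈ Y, ∀ A ⊆ Y, #A = g → (∀ a ∈ A, x < a) →
          c (insert x A) = φ x := by
      intro L
      induction L with
      | zero =>
        exact ⟨0, fun ι _ c X _ => ⟨∅, empty_subset _, le_rfl, fun _ => c ∅, by simp⟩⟩
      | succ L ihL =>
        obtain ⟨N₁, hN₁⟩ := ihL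
        obtain ⟨N₂, hN₂⟩ := ih N₁
        refine ⟨N₂ + 1, fun ι _ c X hX => ?_⟩
        have hne : X.Nonempty := card_pos.1 (by omega)
        set x := X.min' hne with hx
        have hxX : x ∈ X := X.min'_mem hne
        obtain ⟨Y₁, hY₁, hc₁, col, hcol⟩ := hN₂ ι (fun A => c (insert x A)) (X.erase x)
          (by rw [card_erase_of_mem hxX]; omega)
        obtain ⟨Y₂, hY₂, hc₂, φ, hφ⟩ := hN₁ ι c Y₁ hc₁
        have hlt : ∀ y ∈ Y₂, x < y := fun y hy => by
          have := hY₁ (hY₂ hy)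
          rw [mem_erase] at this
          exact lt_of_le_of_ne (X.min'_le y this.2) (Ne.symm this.1)
        have hxY : x ∉ Y₂ := fun h => lt_irrefl _ (hlt x h)
        refine ⟨insert x Y₂, ?_, ?_, Function.update φ x col, ?_⟩
        · exact insert_subset hxX ((hY₂.trans hY₁).trans (erase_subset _ _))
        · rw [card_insert_of_notMem hxY]; omega
        · intro z hz A hA hAg hzA
          have hle : x ≤ z := by
            rcases mem_insert.1 hz with rfl | hz
            · exact le_rfl
            · exact (hlt z hz).le
          have hAY : A ⊆ Y₂ := fun a ha => by
            rcases mem_insert.1 (hA ha) with h | h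
            · exact absurd (hzA a ha) (by rw [h]; exact not_lt.2 hle)
            · exact h
          rcases mem_insert.1 hz with rfl | hz
          · simpa using hcol A (hAY.trans hY₂) hAg
          · rw [Function.update_of_ne (hlt z hz).ne']
            exact hφ z hz A hAY hAg hzA
    intro L
    obtain ⟨N, hN⟩ := key (Fintype.card κ * L)
    refine ⟨N, fun ι _ c X hX => ?_⟩
    obtain ⟨Y, hY, hcY, φ, hφ⟩ := hN ι c X hX
    have : Nonempty κ := ⟨c ∅⟩
    obtain ⟨col, -, hcol⟩ := exists_le_card_fiber_of_mul_le_card_of_maps_to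
      (s := Y) (t := (univ : Finset κ)) (f := φ) (n := L) (fun _ _ => mem_univ _)
      univ_nonempty (by simpa using hcY)
    refine ⟨_, (filter_subset _ _).trans hY, hcol, col, fun A hA hAg => ?_⟩
    have hne : A.Nonempty := card_pos.1 (by omega)
    have hm := A.min'_mem hne
    have h := hφ (A.min' hne) (mem_filter.1 (hA hm)).1 (A.erase (A.min' hne))
      ((erase_subset _ _).trans (hA.trans (filter_subset _ _)))
      (by rw [card_erase_of_mem hm]; omega)
      (fun a ha => lt_of_le_of_ne (A.min'_le a (mem_of_mem_erase ha)) (ne_of_mem_erase ha).symm)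
    rw [insert_erase hm] at h
    rw [h, (mem_filter.1 (hA hm)).2]

theorem Finset.exists_initial_split {ι : Type*} [LinearOrder ι] (Y : Finset ι) :
    ∀ a ≤ #Y, ∃ Y₁ ⊆ Y, ∃ Y₂ ⊆ Y, #Y₁ = a ∧ #Y₂ = #Y - a ∧ ∀ x ∈ Y₁, ∀ y ∈ Y₂, x < y := by
  intro a
  induction a generalizing Y with
  | zero => exact fun _ => ⟨∅, empty_subset _, Y, subset_rfl, rfl, rfl, by simp⟩
  | succ a ih =>
    intro ha
    have hne : Y.Nonempty := card_pos.1 (by omega)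
    have hm := Y.min'_mem hne
    have hc := card_erase_of_mem hm
    obtain ⟨Y₁, h₁, Y₂, h₂, hc₁, hc₂, hlt⟩ := ih (Y.erase (Y.min' hne)) (by omega)
    have hY : ∀ y ∈ Y.erase (Y.min' hne), Y.min' hne < y := fun y hy =>
      lt_of_le_of_ne (Y.min'_le y (mem_of_mem_erase hy)) (ne_of_mem_erase hy).symm
    refine ⟨insert (Y.min' hne) Y₁, insert_subset hm (h₁.trans (erase_subset _ _)), Y₂,
      h₂.trans (erase_subset _ _), ?_, by omega, ?_⟩
    · rw [card_insert_of_notMem (fun h => lt_irrefl _ (hY _ (h₁ h))), hc₁]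
    · intro x hx y hy
      rcases mem_insert.1 hx with rfl | hx
      · exact hY y (h₂ hy)
      · exact hlt x hx y hy

theorem Finset.eq_of_card_filter_lt_eq {ι : Type*} [LinearOrder ι] {A : Finset ι} {x y : ι}
    (hx : x ∈ A) (hy : y ∈ A) (h : #{z ∈ A | z < x} = #{z ∈ A | z < y}) : x = y := by
  have key : ∀ u ∈ A, ∀ v : ι, u < v → #{z ∈ A | z < u} < #{z ∈ A | z < v} := by
    intro u hu v huv
    refine card_lt_card ⟨fun z hz => ?_, fun hsub => ?_⟩
    · rw [mem_filter] at hz ⊢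
      exact ⟨hz.1, hz.2.trans huv⟩
    · exact lt_irrefl u (mem_filter.1 (hsub (mem_filter.2 ⟨hu, huv⟩))).2
  rcases lt_trichotomy x y with hxy | hxy | hxy
  · exact absurd h (key x hx y hxy).ne
  · exact hxy
  · exact absurd h (key y hy x hxy).ne'

/-- A set that is split as `E₁ < t < i < E₂` determines the split once `#E₁` is known. -/
theorem Finset.split_pair_unique {ι : Type*} [LinearOrder ι] {E₁ E₂ F₁ F₂ : Finset ι}
    {t i u j : ι} (hE₁ : ∀ x ∈ E₁, x < t) (hti : t < i) (hE₂ : ∀ x ∈ E₂, i < x)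
    (hF₁ : ∀ x ∈ F₁, x < u) (huj : u < j) (hF₂ : ∀ x ∈ F₂, j < x) (hc : #E₁ = #F₁)
    (h : insert t (insert i (E₁ ∪ E₂)) = insert u (insert j (F₁ ∪ F₂))) :
    t = u ∧ i = j ∧ E₁ ∪ E₂ = F₁ ∪ F₂ := by
  classical
  have low : ∀ {E₁ E₂ : Finset ι} {t i : ι}, (∀ x ∈ E₁, x < t) → t < i → (∀ x ∈ E₂, i < x) →
      {z ∈ insert t (insert i (E₁ ∪ E₂)) | z < t} = E₁ ∧
      {z ∈ insert t (insert i (E₁ ∪ E₂)) | z < i} = insert t E₁ ∧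
      ((insert t (insert i (E₁ ∪ E₂))).erase t).erase i = E₁ ∪ E₂ := by
    intro E₁ E₂ t i h₁ h h₂
    refine ⟨?_, ?_, ?_⟩
    · ext z
      simp only [mem_filter, mem_insert, mem_union]
      constructor
      · rintro ⟨rfl | rfl | hz | hz, hlt⟩
        · exact absurd hlt (lt_irrefl _)
        · exact absurd hlt h.not_gt
        · exact hz
        · exact absurd (hlt.trans h) (h₂ z hz).not_gt
      · exact fun hz => ⟨Or.inr (Or.inr (Or.inl hz)), h₁ z hz⟩
    · ext z
      simp only [mem_filter, mem_insert, mem_union]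
      constructor
      · rintro ⟨rfl | rfl | hz | hz, hlt⟩
        · exact Or.inl rfl
        · exact absurd hlt (lt_irrefl _)
        · exact Or.inr hz
        · exact absurd hlt (h₂ z hz).not_gt
      · rintro (rfl | hz)
        · exact ⟨Or.inl rfl, h⟩
        · exact ⟨Or.inr (Or.inr (Or.inl hz)), (h₁ z hz).trans h⟩
    · ext z
      simp only [mem_erase, mem_insert, mem_union]
      constructor
      · rintro ⟨hi, ht, rfl | rfl | hz⟩
        · exact absurd rfl ht
        · exact absurd rfl hi
        · exact hz
      · intro hz
        refine ⟨?_, ?_, Or.inr (Or.inr hz)⟩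
        · rintro rfl
          rcases hz with hz | hz
          · exact absurd (h₁ _ hz) h.not_gt
          · exact lt_irrefl _ (h₂ _ hz)
        · rintro rfl
          rcases hz with hz | hz
          · exact lt_irrefl _ (h₁ _ hz)
          · exact absurd (h₂ _ hz) h.not_gt
  obtain ⟨e1, e2, e3⟩ := low hE₁ hti hE₂
  obtain ⟨f1, f2, f3⟩ := low hF₁ huj hF₂
  -- In the common set, t is the element of rank #E₁ and i the one of rank #E₁ + 1.
  have htu : t = u := by
    apply eq_of_card_filter_lt_eq (A := insert t (insert i (E₁ ∪ E₂)))
    · simp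
    · rw [h]; simp
    · rw [e1, hc]; rw [h, f1]
  have hij : i = j := by
    apply eq_of_card_filter_lt_eq (A := insert t (insert i (E₁ ∪ E₂)))
    · simp
    · rw [h]; simp
    · rw [e2, h, f2, card_insert_of_notMem (fun h => lt_irrefl _ (hE₁ _ h)),
        card_insert_of_notMem (fun h => lt_irrefl _ (hF₁ _ h)), hc]
  refine ⟨htu, hij, ?_⟩
  rw [← e3, ← f3, h, htu, hij]

/-! ### Binomial trees and the embedding of arbitrary trees. -/

namespace SimpleGraph

open Classical in
/-- `G.IsBinomialCopy m r S`: the set `S` induces in `G` the binomial tree of order `m`, rooted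
at `r`. -/
def IsBinomialCopy {V : Type*} (G : SimpleGraph V) : ℕ → V → Finset V → Prop
  | 0, r, S => S = {r}
  | m + 1, r, S => ∃ r' S₁ S₂, G.IsBinomialCopy m r S₁ ∧ G.IsBinomialCopy m r' S₂ ∧
      Disjoint S₁ S₂ ∧ S = S₁ ∪ S₂ ∧ G.Adj r r' ∧
      ∀ x ∈ S₁, ∀ y ∈ S₂, G.Adj x y → x = r ∧ y = r'

section IsBinomialCopy
variable {V : Type*} {G : SimpleGraph V}

theorem IsBinomialCopy.root_mem {m : ℕ} {r : V} {S : Finset V} (h : G.IsBinomialCopy m r S) :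
    r ∈ S := by
  classical
  induction m generalizing r S with
  | zero => simp [show S = {r} from h]
  | succ m ih =>
    obtain ⟨r', S₁, S₂, h₁, -, -, rfl, -⟩ := h
    exact mem_union_left _ (ih h₁)

theorem IsBinomialCopy.card_eq {m : ℕ} {r : V} {S : Finset V} (h : G.IsBinomialCopy m r S) :
    #S = 2 ^ m := by
  classical
  induction m generalizing r S with
  | zero => simp [show S = {r} from h]
  | succ m ih =>
    obtain ⟨r', S₁, S₂, h₁, h₂, hd, rfl, -⟩ := h
    rw [card_union_of_disjoint hd, ih h₁, ih h₂]
    ring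

theorem IsBinomialCopy.exists_subset {m b : ℕ} {r : V} {S : Finset V}
    (h : G.IsBinomialCopy m r S) (hb : b ≤ m) : ∃ S' ⊆ S, G.IsBinomialCopy b r S' := by
  classical
  induction m generalizing r S with
  | zero =>
    obtain rfl : b = 0 := by omega
    exact ⟨S, subset_rfl, h⟩
  | succ m ih =>
    rcases hb.eq_or_lt with rfl | hb
    · exact ⟨S, subset_rfl, h⟩
    · obtain ⟨r', S₁, S₂, h₁, h₂, hd, rfl, -⟩ := h
      obtain ⟨S', hS', h'⟩ := ih h₁ (by omega)
      exact ⟨S', hS'.trans subset_union_left, h'⟩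

end IsBinomialCopy

open Classical in
/-- Vertex sets that induce a rooted tree, built by joining two smaller ones by an edge between
their roots. -/
inductive RootedTreeOn {U : Type*} (T : SimpleGraph U) : Finset U → U → Prop
  | single (u : U) : RootedTreeOn T {u} u
  | join {A B : Finset U} {u c : U} : RootedTreeOn T A u → RootedTreeOn T B c → Disjoint A B →
      T.Adj u c → (∀ x ∈ A, ∀ y ∈ B, T.Adj x y → x = u ∧ y = c) → RootedTreeOn T (A ∪ B) u

section RootedTreeOn
variable {U : Type*} {T : SimpleGraph U}

theorem RootedTreeOn.root_mem {A : Finset U} {u : U} (h : T.RootedTreeOn A u) : u ∈ A := by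
  classical
  induction h with
  | single u => simp
  | join _ _ _ _ _ ih _ => exact mem_union_left _ ih

theorem RootedTreeOn.exists_walk {A : Finset U} {u : U} (h : T.RootedTreeOn A u) :
    ∀ x ∈ A, ∃ p : T.Walk u x, ∀ z ∈ p.support, z ∈ A := by
  classical
  induction h with
  | single u =>
    intro x hx
    obtain rfl := mem_singleton.1 hx
    exact ⟨.nil, by simp⟩
  | @join A B u c hA hB _ hadj _ ihA ihB =>
    intro x hx
    rcases mem_union.1 hx with hx | hx
    · obtain ⟨p, hp⟩ := ihA x hx
      exact ⟨p, fun z hz => mem_union_left _ (hp z hz)⟩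
    · obtain ⟨p, hp⟩ := ihB x hx
      refine ⟨.cons hadj p, fun z hz => ?_⟩
      rw [Walk.support_cons, List.mem_cons] at hz
      rcases hz with rfl | hz
      · exact mem_union_left _ hA.root_mem
      · exact mem_union_right _ (hp z hz)

open Classical in
-- The leaf goes into the half containing its only neighbour, so the joining edge stays the only one
-- between the halves. This reconciles growth by leaves with decomposition at the root.
theorem RootedTreeOn.insert_leaf {A : Finset U} {u : U} (h : T.RootedTreeOn A u) {x w : U}
    (hx : x ∉ A) (hw : w ∈ A) (hwx : T.Adj w x) (huniq : ∀ y ∈ A, T.Adj y x → y = w) :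
    T.RootedTreeOn (insert x A) u := by
  induction h with
  | single u =>
    obtain rfl := mem_singleton.1 hw
    have := RootedTreeOn.join (.single w) (.single x) (by simpa using hwx.ne) hwx
      (by simp)
    convert this using 1
    ext; simp [or_comm]
  | @join A B u c hA hB hd hadj hAB ihA ihB =>
    rw [mem_union, not_or] at hx
    rcases mem_union.1 hw with hw | hw
    · rw [← insert_union]
      refine .join (ihA hx.1 hw fun y hy => huniq y (mem_union_left _ hy)) hB ?_ hadj ?_
      · rw [disjoint_insert_left]; exact ⟨hx.2, hd⟩
      · intro a ha b hb hab
        rcases mem_insert.1 ha with rfl | ha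
        · have := huniq b (mem_union_right _ hb) hab.symm
          subst this
          exact absurd hb (Finset.disjoint_left.1 hd hw)
        · exact hAB a ha b hb hab
    · rw [← union_insert]
      refine .join hA (ihB hx.2 hw fun y hy => huniq y (mem_union_right _ hy)) ?_ hadj ?_
      · rw [disjoint_insert_right]; exact ⟨hx.1, hd⟩
      · intro a ha b hb hab
        rcases mem_insert.1 hb with rfl | hb
        · have := huniq a (mem_union_left _ ha) hab
          subst this
          exact absurd hw (Finset.disjoint_left.1 hd ha)
        · exact hAB a ha b hb hab

theorem IsTree.rootedTreeOn_univ [Fintype U] (hT : T.IsTree) (u : U) :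
    T.RootedTreeOn univ u := by
  classical
  have key : ∀ k ≤ Fintype.card U, 1 ≤ k → ∃ A : Finset U, #A = k ∧ T.RootedTreeOn A u := by
    intro k
    induction k with
    | zero => intro _ h; omega
    | succ k ih =>
      intro hk _
      rcases Nat.eq_zero_or_pos k with rfl | hpos
      · exact ⟨{u}, by simp, .single u⟩
      · obtain ⟨A, hc, hA⟩ := ih (by omega) hpos
        have hne : ∃ v, v ∉ A := by
          by_contra! hall
          have : A = univ := eq_univ_iff_forall.2 hall
          rw [this, card_univ] at hc
          omega
        obtain ⟨v, hv⟩ := hne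
        obtain ⟨p⟩ := hT.1.preconnected u v
        obtain ⟨d, -, hd₁, hd₂⟩ := p.exists_boundary_dart (A : Set U) hA.root_mem hv
        refine ⟨insert d.snd A, by rw [card_insert_of_notMem hd₂, hc],
          hA.insert_leaf hd₂ hd₁ d.adj fun y hy hyx => ?_⟩
        -- A second neighbour y of the new vertex in A would give two paths from y to `d.fst`: one
        -- inside A and one through `d.snd`, which is outside A.
        by_contra hne
        obtain ⟨p₁, hp₁⟩ := hA.exists_walk y hy
        obtain ⟨p₂, hp₂⟩ := hA.exists_walk d.fst hd₁
        set q := (p₁.reverse.append p₂).toPath with hq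
        have hqs : ∀ z ∈ (q : T.Walk y d.fst).support, z ∈ A := by
          intro z hz
          have := Walk.support_toPath_subset_support _ hz
          rw [Walk.mem_support_append_iff, Walk.support_reverse, List.mem_reverse] at this
          exact this.elim (hp₁ z) (hp₂ z)
        have hpath : (Walk.cons hyx (Walk.cons d.adj.symm Walk.nil)).IsPath := by
          simp [Walk.cons_isPath_iff, hyx.ne, d.adj.ne', hne]
        have heq := @Subsingleton.elim _ (hT.2.subsingleton_path y d.fst) q ⟨_, hpath⟩
        have : d.snd ∈ (q : T.Walk y d.fst).support := by rw [heq]; simp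
        exact hd₂ (hqs _ this)
  obtain ⟨A, hc, hA⟩ := key (Fintype.card U) le_rfl (Fintype.card_pos_iff.2 ⟨u⟩)
  rwa [(card_eq_iff_eq_univ A).1 hc] at hA

/-- Both sides of a join are nonempty, so each has at most m vertices and fits, root to root, into
one of the two halves of order m - 1. -/
theorem RootedTreeOn.exists_embedding {A : Finset U} {u : U} (hA : T.RootedTreeOn A u)
    {V : Type*} {G : SimpleGraph V} {m : ℕ} {r : V} {S : Finset V} (hS : G.IsBinomialCopy m r S)
    (hm : #A ≤ m + 1) :
    ∃ f : U → V, Set.InjOn f A ∧ (∀ x ∈ A, f x ∈ S) ∧ f u = r ∧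
      ∀ x ∈ A, ∀ y ∈ A, G.Adj (f x) (f y) ↔ T.Adj x y := by
  classical
  induction hA generalizing m r S with
  | single u =>
    refine ⟨fun _ => r, by simp, fun _ _ => hS.root_mem, rfl, ?_⟩
    simp
  | @join A B u c hA hB hd hadj hAB ihA ihB =>
    rw [card_union_of_disjoint hd] at hm
    have hA0 : 0 < #A := card_pos.2 ⟨_, hA.root_mem⟩
    have hB0 : 0 < #B := card_pos.2 ⟨_, hB.root_mem⟩
    obtain ⟨m, rfl⟩ : ∃ k, m = k + 1 := ⟨m - 1, by omega⟩
    obtain ⟨r', S₁, S₂, h₁, h₂, hdS, rfl, hr, hS⟩ := hS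
    obtain ⟨f, hf, hfS, hfu, hfa⟩ := ihA h₁ (by omega)
    obtain ⟨k, hk, hkS, hkc, hka⟩ := ihB h₂ (by omega)
    have hBA : ∀ x ∈ B, x ∉ A := fun x hx hx' => Finset.disjoint_left.1 hd hx' hx
    have hF : ∀ x ∈ A, (if x ∈ A then f x else k x) = f x := fun x hx => if_pos hx
    have hK : ∀ x ∈ B, (if x ∈ A then f x else k x) = k x := fun x hx => if_neg (hBA x hx)
    have hcross : ∀ x ∈ A, ∀ y ∈ B, f x ≠ k y := fun x hx y hy h =>
      Finset.disjoint_left.1 hdS (hfS x hx) (h ▸ hkS y hy)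
    have hcadj : ∀ x ∈ A, ∀ y ∈ B, G.Adj (f x) (k y) ↔ T.Adj x y := by
      intro x hx y hy
      constructor
      · intro h
        obtain ⟨e₁, e₂⟩ := hS _ (hfS x hx) _ (hkS y hy) h
        rw [hf hx hA.root_mem (e₁.trans hfu.symm), hk hy hB.root_mem (e₂.trans hkc.symm)]
        exact hadj
      · intro h
        obtain ⟨rfl, rfl⟩ := hAB x hx y hy h
        rw [hfu, hkc]
        exact hr
    refine ⟨fun x => if x ∈ A then f x else k x, ?_, ?_, ?_, ?_⟩
    · intro x hx y hy hxy
      rw [mem_coe, mem_union] at hx hy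
      rcases hx with hx | hx <;> rcases hy with hy | hy
      · simp only [hF x hx, hF y hy] at hxy; exact hf hx hy hxy
      · simp only [hF x hx, hK y hy] at hxy; exact absurd hxy (hcross x hx y hy)
      · simp only [hK x hx, hF y hy] at hxy; exact absurd hxy.symm (hcross y hy x hx)
      · simp only [hK x hx, hK y hy] at hxy; exact hk hx hy hxy
    · intro x hx
      rcases mem_union.1 hx with hx | hx
      · simp only [hF x hx]; exact mem_union_left _ (hfS x hx)
      · simp only [hK x hx]; exact mem_union_right _ (hkS x hx)
    · simp only [hF u hA.root_mem]; exact hfu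
    · intro x hx y hy
      rcases mem_union.1 hx with hx | hx <;> rcases mem_union.1 hy with hy | hy
      · simp only [hF x hx, hF y hy]; exact hfa x hx y hy
      · simp only [hF x hx, hK y hy]; exact hcadj x hx y hy
      · simp only [hK x hx, hF y hy]; rw [G.adj_comm, T.adj_comm]; exact hcadj y hy x hx
      · simp only [hK x hx, hK y hy]; exact hka x hx y hy

end RootedTreeOn

end SimpleGraph

/-! ### Finite counting: saturation, medians and greedy coverings. -/

namespace Finset

open Classical in
-- Keep adding to U any y with 2 #(D y \ D(U)) > #(R y \ D(U)). Each addition enlarges D(U), by more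
-- than half of what it adds to R(U), so the first two bounds persist. The process ends when D(U)
-- first reaches θ, overshooting by at most Δ, or when no such y remains.
theorem exists_saturated_subset {α τ : Type*} (Y : Finset α) (R D : α → Finset τ) {θ Δ : ℝ}
    (hθ : 0 < θ) (hΔ : ∀ y ∈ Y, (#(D y) : ℝ) ≤ Δ) :
    ∃ U ⊆ Y, #U ≤ #(U.biUnion D) ∧ #(U.biUnion R \ U.biUnion D) ≤ 2 * #(U.biUnion D) ∧
      (θ ≤ #(U.biUnion D) ∧ (#(U.biUnion D) : ℝ) ≤ θ + Δ ∨
        (#(U.biUnion D) : ℝ) < θ ∧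
          ∀ y ∈ Y, y ∉ U → 2 * #(D y \ U.biUnion D) ≤ #(R y \ U.biUnion D)) := by
  set P : Finset (Finset α) := {U ∈ Y.powerset | #U ≤ #(U.biUnion D) ∧
    #(U.biUnion R \ U.biUnion D) ≤ 2 * #(U.biUnion D) ∧ (#(U.biUnion D) : ℝ) < θ} with hP
  have hne : P.Nonempty := ⟨∅, by simp [hP, hθ]⟩
  obtain ⟨U, hU, hmax⟩ := exists_max_image P card hne
  rw [hP, mem_filter, mem_powerset] at hU
  obtain ⟨hUY, hU₁, hU₂, hU₃⟩ := hU
  by_cases hall : ∀ y ∈ Y, y ∉ U → 2 * #(D y \ U.biUnion D) ≤ #(R y \ U.biUnion D)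
  · exact ⟨U, hUY, hU₁, hU₂, Or.inr ⟨hU₃, hall⟩⟩
  push Not at hall
  obtain ⟨y, hyY, hyU, hy⟩ := hall
  have hD : (insert y U).biUnion D = U.biUnion D ∪ (D y \ U.biUnion D) := by
    rw [biUnion_insert, union_sdiff_self_eq_union, union_comm]
  have hDc : #((insert y U).biUnion D) = #(U.biUnion D) + #(D y \ U.biUnion D) := by
    rw [hD, card_union_of_disjoint disjoint_sdiff]
  have hc : #(insert y U) = #U + 1 := card_insert_of_notMem hyU
  have h₁ : #(insert y U) ≤ #((insert y U).biUnion D) := by omega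
  have h₂ : #((insert y U).biUnion R \ (insert y U).biUnion D) ≤
      2 * #((insert y U).biUnion D) := by
    have hsub : (insert y U).biUnion R \ (insert y U).biUnion D ⊆
        (U.biUnion R \ U.biUnion D) ∪ (R y \ U.biUnion D) := by
      intro t ht
      rw [biUnion_insert, biUnion_insert, mem_sdiff, mem_union, mem_union, not_or] at ht
      rw [mem_union, mem_sdiff, mem_sdiff]
      tauto
    have := (card_le_card hsub).trans (card_union_le _ _)
    omega
  have hsub : insert y U ⊆ Y := insert_subset hyY hUY
  have h₃ : θ ≤ #((insert y U).biUnion D) := by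
    by_contra! hlt
    have := hmax (insert y U) (by
      rw [hP, mem_filter, mem_powerset]; exact ⟨hsub, h₁, h₂, hlt⟩)
    omega
  refine ⟨insert y U, hsub, h₁, h₂, Or.inl ⟨h₃, ?_⟩⟩
  have h₄ : (#(D y \ U.biUnion D) : ℝ) ≤ Δ :=
    le_trans (by exact_mod_cast card_le_card sdiff_subset) (hΔ y hyY)
  rw [hDc]
  push_cast
  linarith

/-- Take the largest q such that at least half of some S j has d ≥ q; then q + 1 fails for every
block, which is the second bound. -/
theorem exists_common_median {ι α : Type*} {I : Finset ι} (hI : I.Nonempty) (S : ι → Finset α)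
    (hS : ∀ i ∈ I, (S i).Nonempty) (d : α → ℕ) :
    ∃ j ∈ I, ∃ q, #(S j) ≤ 2 * #{y ∈ S j | q ≤ d y} ∧
      ∀ k ∈ I, #(S k) ≤ 2 * #{y ∈ S k | d y ≤ q} := by
  classical
  set P : ℕ → Prop := fun q => ∃ j ∈ I, #(S j) ≤ 2 * #{y ∈ S j | q ≤ d y} with hP
  set M := I.sup fun j => (S j).sup d with hM
  have h0 : P 0 := by
    obtain ⟨j, hj⟩ := hI
    refine ⟨j, hj, ?_⟩
    rw [filter_true_of_mem (fun _ _ => Nat.zero_le _)]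
    omega
  have hM1 : ¬ P (M + 1) := by
    rintro ⟨j, hj, h⟩
    have : {y ∈ S j | M + 1 ≤ d y} = ∅ := by
      refine filter_eq_empty_iff.2 fun y hy hle => ?_
      have h₁ : d y ≤ (S j).sup d := le_sup (f := d) hy
      have h₂ : (S j).sup d ≤ M := le_sup (f := fun j => (S j).sup d) hj
      omega
    rw [this, card_empty] at h
    have := card_pos.2 (hS j hj)
    omega
  have hq : P (Nat.findGreatest P (M + 1)) := Nat.findGreatest_spec (Nat.zero_le _) h0
  set q := Nat.findGreatest P (M + 1) with hqdef
  have hqle : q ≤ M + 1 := Nat.findGreatest_le _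
  have hqlt : q < M + 1 := lt_of_le_of_ne hqle (fun h => hM1 (h ▸ hq))
  have hsucc : ¬ P (q + 1) := Nat.findGreatest_is_greatest (Nat.lt_succ_self q) (by omega)
  obtain ⟨j, hj, hjq⟩ := hq
  refine ⟨j, hj, q, hjq, fun k hk => ?_⟩
  have h₁ : 2 * #{y ∈ S k | q + 1 ≤ d y} < #(S k) := by
    by_contra! hle
    exact hsucc ⟨k, hk, hle⟩
  have h₂ := card_filter_add_card_filter_not (s := S k) (fun y => d y ≤ q)
  have h₃ : {y ∈ S k | ¬ d y ≤ q} = {y ∈ S k | q + 1 ≤ d y} :=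
    filter_congr fun y _ => by omega
  rw [h₃] at h₂
  omega

open Classical in
-- Elements are added to X greedily, keeping the total fraction of the Z k touched at most 6 #I
-- times the fraction of Y covered. While less than 1/(24 #I) of Y is covered, averaging supplies
-- the next element: at least half of Y is uncovered, with #(A y) ≥ q/2, while the touched fractions
-- sum to at most #I · 3q/2 over all of Ω, and the ratio of #I · 3q/2 to q/4 is 6 #I. One element
-- covers at most 1/(24 #I), so the final coverage is at most 1/(12 #I) and the touched fraction at
-- most 1/2.
theorem exists_covering_subset {ι α τ : Type*} {I : Finset ι} (hI : I.Nonempty)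
    (Z : ι → Finset α) {Y : Finset α} (hY : Y.Nonempty) (Ω : Finset τ) (A B : α → Finset τ)
    {q : ℕ} (hq : 0 < q) (hAΩ : ∀ y ∈ Y, A y ⊆ Ω) (hA : ∀ y ∈ Y, q ≤ 2 * #(A y))
    (hB : ∀ k ∈ I, ∀ y ∈ Z k, 2 * #(B y) ≤ 3 * q)
    (hΔ : ∀ t ∈ Ω, 24 * #I * #{y ∈ Y | t ∈ A y} ≤ #Y) :
    ∃ X ⊆ Ω, #Y ≤ 24 * #I * #{y ∈ Y | ∃ t ∈ X, t ∈ A y} ∧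
      ∀ k ∈ I, 2 * #{y ∈ Z k | ∃ t ∈ X, t ∈ B y} ≤ #(Z k) := by
  classical
  set cov : Finset τ → Finset α := fun X => {y ∈ Y | ∃ t ∈ X, t ∈ A y} with hcov
  set tch : Finset τ → ι → Finset α := fun X k => {y ∈ Z k | ∃ t ∈ X, t ∈ B y} with htch
  set good : Finset τ → Prop := fun X =>
    ∑ k ∈ I, (#(tch X k) : ℝ) / #(Z k) ≤ 6 * #I * #(cov X) / #Y with hgood
  set P : Finset (Finset τ) := {X ∈ Ω.powerset | good X ∧ 24 * #I * #(cov X) < #Y} with hP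
  have hYpos : 0 < #Y := card_pos.2 hY
  have hYpos' : (0 : ℝ) < #Y := by exact_mod_cast hYpos
  have hIpos : 0 < #I := card_pos.2 hI
  have hIpos' : (0 : ℝ) < #I := by exact_mod_cast hIpos
  have hne : P.Nonempty := by
    refine ⟨∅, ?_⟩
    rw [hP, mem_filter]
    refine ⟨empty_mem_powerset _, ?_, ?_⟩ <;> simp [hgood, hcov, htch, hYpos]
  obtain ⟨X, hX, hmax⟩ := exists_max_image P card hne
  rw [hP, mem_filter, mem_powerset] at hX
  obtain ⟨hXΩ, hXg, hXc⟩ := hX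
  set new : τ → Finset α := fun t => {y ∈ Y \ cov X | t ∈ A y} with hnew
  set hit : τ → ℝ := fun t => ∑ k ∈ I, (#{y ∈ Z k | t ∈ B y} : ℝ) / #(Z k) with hhit
  have hex : ∃ t ∈ Ω, 0 < #(new t) ∧ hit t ≤ 6 * #I * #(new t) / #Y := by
    by_contra! hall
    have hle : ∀ t ∈ Ω, 6 * #I * #(new t) / #Y ≤ hit t := by
      intro t ht
      rcases Nat.eq_zero_or_pos #(new t) with h | h
      · rw [h]; simp only [Nat.cast_zero, mul_zero, zero_div]
        exact sum_nonneg fun k _ => by positivity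
      · exact (hall t ht h).le
    have hsum₁ : ∑ t ∈ Ω, #(new t) = ∑ y ∈ Y \ cov X, #{t ∈ Ω | t ∈ A y} :=
      sum_card_bipartiteAbove_eq_sum_card_bipartiteBelow (s := Ω) (t := Y \ cov X)
        (fun t y => t ∈ A y)
    have hcsub : cov X ⊆ Y := filter_subset _ _
    have hcc : #(Y \ cov X) = #Y - #(cov X) := card_sdiff_of_subset hcsub
    have hhalf : #Y ≤ 2 * #(Y \ cov X) := by nlinarith [Nat.sub_add_cancel (card_le_card hcsub)]
    have hsum₂ : #(Y \ cov X) * q ≤ 2 * ∑ t ∈ Ω, #(new t) := by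
      rw [hsum₁, mul_sum, ← smul_eq_mul]
      refine card_nsmul_le_sum _ _ _ fun y hy => ?_
      have hyY := (mem_sdiff.1 hy).1
      rw [filter_mem_eq_inter, inter_eq_right.2 (hAΩ y hyY)]
      exact hA y hyY
    have hpos : 0 < ∑ t ∈ Ω, #(new t) := by nlinarith
    have hstrict : ∑ t ∈ Ω, 6 * #I * (#(new t) : ℝ) / #Y < ∑ t ∈ Ω, hit t := by
      obtain ⟨t, ht, htp⟩ : ∃ t ∈ Ω, 0 < #(new t) := by
        by_contra! h
        rw [sum_eq_zero fun t ht => Nat.le_zero.1 (h t ht)] at hpos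
        exact lt_irrefl _ hpos
      exact sum_lt_sum hle ⟨t, ht, hall t ht htp⟩
    have hupper : ∑ t ∈ Ω, hit t ≤ #I * (3 * q / 2 : ℝ) := by
      rw [hhit, sum_comm, ← nsmul_eq_mul]
      refine sum_le_card_nsmul _ _ _ fun k hk => ?_
      rw [← sum_div]
      rcases Nat.eq_zero_or_pos #(Z k) with h | h
      · rw [h]; simp only [Nat.cast_zero, div_zero]; positivity
      · rw [div_le_iff₀ (by exact_mod_cast h)]
        have h₁ : ∑ t ∈ Ω, #{y ∈ Z k | t ∈ B y} = ∑ y ∈ Z k, #{t ∈ Ω | t ∈ B y} :=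
          sum_card_bipartiteAbove_eq_sum_card_bipartiteBelow (s := Ω) (t := Z k)
            (fun t y => t ∈ B y)
        have h₂ : 2 * ∑ y ∈ Z k, #{t ∈ Ω | t ∈ B y} ≤ #(Z k) * (3 * q) := by
          rw [mul_sum, ← smul_eq_mul]
          refine sum_le_card_nsmul _ _ _ fun y hy => ?_
          refine le_trans (Nat.mul_le_mul_left 2 (card_le_card fun t ht => ?_)) (hB k hk y hy)
          exact (mem_filter.1 ht).2
        rw [← h₁] at h₂
        have h₃ : (2 : ℝ) * ∑ t ∈ Ω, (#{y ∈ Z k | t ∈ B y} : ℝ) ≤ #(Z k) * (3 * q) := by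
          exact_mod_cast h₂
        linarith
    have hlower : #I * (3 * q / 2 : ℝ) ≤ ∑ t ∈ Ω, 6 * #I * (#(new t) : ℝ) / #Y := by
      rw [← sum_div, ← mul_sum, le_div_iff₀ hYpos']
      have h₁ : (#Y : ℝ) ≤ 2 * #(Y \ cov X) := by exact_mod_cast hhalf
      have h₂ : (#(Y \ cov X) : ℝ) * q ≤ 2 * ∑ t ∈ Ω, (#(new t) : ℝ) := by exact_mod_cast hsum₂
      have hq' : (0 : ℝ) < q := by exact_mod_cast hq
      have h₃ : (#Y : ℝ) * q ≤ 4 * ∑ t ∈ Ω, (#(new t) : ℝ) := by nlinarith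
      nlinarith
    linarith
  obtain ⟨t, htΩ, htn, hth⟩ := hex
  have htX : t ∉ X := by
    intro htX
    obtain ⟨y, hy⟩ := card_pos.1 htn
    rw [hnew, mem_filter, mem_sdiff, hcov, mem_filter] at hy
    exact hy.1.2 ⟨hy.1.1, t, htX, hy.2⟩
  have hcov' : cov (insert t X) = cov X ∪ new t := by
    ext y
    simp only [hcov, hnew, mem_filter, mem_union, mem_sdiff, mem_insert, exists_eq_or_imp]
    by_cases h : ∃ t ∈ X, t ∈ A y
    · simp only [h, or_true, and_true]
      tauto
    · simp only [h, or_false, and_false, not_false_eq_true, and_true, false_or]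
  have hcc : #(cov (insert t X)) = #(cov X) + #(new t) := by
    rw [hcov', card_union_of_disjoint]
    exact Finset.disjoint_left.2 fun y hy hy' => (mem_sdiff.1 (mem_filter.1 hy').1).2 hy
  have hg : good (insert t X) := by
    have h₁ : ∀ k ∈ I, (#(tch (insert t X) k) : ℝ) / #(Z k) ≤
        #(tch X k) / #(Z k) + (#{y ∈ Z k | t ∈ B y} : ℝ) / #(Z k) := by
      intro k _
      rw [← add_div]
      refine div_le_div_of_nonneg_right ?_ (by positivity)
      have : tch (insert t X) k ⊆ tch X k ∪ {y ∈ Z k | t ∈ B y} := by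
        intro y hy
        simp only [htch, mem_filter, mem_union, mem_insert, exists_eq_or_imp] at hy ⊢
        exact hy.2.elim (fun h => Or.inr ⟨hy.1, h⟩) (fun h => Or.inl ⟨hy.1, h⟩)
      exact_mod_cast (card_le_card this).trans (card_union_le _ _)
    have h₂ := sum_le_sum h₁
    rw [sum_add_distrib] at h₂
    have h₃ : (6 * #I * #(cov (insert t X)) / #Y : ℝ) =
        6 * #I * #(cov X) / #Y + 6 * #I * #(new t) / #Y := by
      rw [hcc]; push_cast; ring
    show _ ≤ _
    rw [h₃]
    exact h₂.trans (add_le_add hXg hth)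
  have hsub : insert t X ⊆ Ω := insert_subset htΩ hXΩ
  have hbig : #Y ≤ 24 * #I * #(cov (insert t X)) := by
    by_contra! hlt
    have := hmax (insert t X) (by rw [hP, mem_filter, mem_powerset]; exact ⟨hsub, hg, hlt⟩)
    rw [card_insert_of_notMem htX] at this
    omega
  refine ⟨insert t X, hsub, ?_, fun k hk => ?_⟩
  · convert hbig
  have hnewle : 24 * #I * #(new t) ≤ #Y :=
    le_trans (Nat.mul_le_mul_left _ (card_le_card (filter_subset_filter _ sdiff_subset)))
      (hΔ t htΩ)
  have hfin : 24 * #I * #(cov (insert t X)) ≤ 2 * #Y := by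
    rw [hcc, mul_add]; omega
  have hk₁ : (#(tch (insert t X) k) : ℝ) / #(Z k) ≤ 1 / 2 := by
    refine (single_le_sum (f := fun k => (#(tch (insert t X) k) : ℝ) / #(Z k))
      (fun k _ => by positivity) hk).trans (le_trans hg ?_)
    rw [div_le_div_iff₀ hYpos' two_pos]
    have : (24 * #I * #(cov (insert t X)) : ℝ) ≤ 2 * #Y := by exact_mod_cast hfin
    linarith
  have hk₂ : 2 * #(tch (insert t X) k) ≤ #(Z k) := by
    rcases Nat.eq_zero_or_pos #(Z k) with h | h
    · have : #(tch (insert t X) k) ≤ #(Z k) := card_le_card (filter_subset _ _)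
      omega
    · rw [div_le_div_iff₀ (by exact_mod_cast h) two_pos] at hk₁
      have : ((2 * #(tch (insert t X) k) : ℕ) : ℝ) ≤ (#(Z k) : ℕ) := by push_cast; linarith
      exact_mod_cast this
  convert hk₂

end Finset

/-! ### Copies of binomial trees placed in blocks. -/

namespace SimpleGraph

/-- A copy of the binomial tree of order `m` with at most one vertex in each of the blocks `s k`,
`k ∈ A`, and with its root `r` in the block `s i`. -/
def IsPlacedCopy {V ι : Type*} (G : SimpleGraph V) (s : ι → Finset V) (m : ℕ) (A : Finset ι)
    (i : ι) (r : V) (S : Finset V) : Prop :=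
  G.IsBinomialCopy m r S ∧
    ∃ f : V → ι, Set.InjOn f S ∧ (∀ x ∈ S, f x ∈ A ∧ x ∈ s (f x)) ∧ f r = i

namespace IsPlacedCopy

variable {V ι : Type*} {G : SimpleGraph V} {s : ι → Finset V} {m : ℕ} {A : Finset ι} {i : ι}
  {r : V} {S : Finset V}

theorem root_mem (h : G.IsPlacedCopy s m A i r S) : r ∈ S := h.1.root_mem

theorem root_mem_block (h : G.IsPlacedCopy s m A i r S) : r ∈ s i := by
  obtain ⟨f, -, hf, rfl⟩ := h.2
  exact (hf r h.root_mem).2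

theorem exists_mem_block (h : G.IsPlacedCopy s m A i r S) {x : V} (hx : x ∈ S) :
    ∃ k ∈ A, x ∈ s k := by
  obtain ⟨f, -, hf, -⟩ := h.2
  exact ⟨f x, hf x hx⟩

theorem exists_ne_mem_block (h : G.IsPlacedCopy s m A i r S) {x : V} (hx : x ∈ S) (hxr : x ≠ r) :
    ∃ k ∈ A, k ≠ i ∧ x ∈ s k := by
  obtain ⟨f, hinj, hf, rfl⟩ := h.2
  exact ⟨f x, (hf x hx).1, fun he => hxr (hinj hx h.root_mem he), (hf x hx).2⟩

theorem mono {s' : ι → Finset V} {A' : Finset ι} (h : G.IsPlacedCopy s m A i r S)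
    (hs : s ≤ s') (hA : A ⊆ A') : G.IsPlacedCopy s' m A' i r S := by
  obtain ⟨h, f, hinj, hf, hr⟩ := h
  exact ⟨h, f, hinj, fun x hx => ⟨hA (hf x hx).1, hs _ (hf x hx).2⟩, hr⟩

theorem exists_subset {b : ℕ} (h : G.IsPlacedCopy s m A i r S) (hb : b ≤ m) :
    ∃ S' ⊆ S, G.IsPlacedCopy s b A i r S' := by
  obtain ⟨h, f, hinj, hf, hr⟩ := h
  obtain ⟨S', hS', h'⟩ := h.exists_subset hb
  exact ⟨S', hS', h', f, hinj.mono (coe_subset.2 hS'), fun x hx => hf x (hS' hx), hr⟩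

theorem exists_index_subset (h : G.IsPlacedCopy s m A i r S) :
    ∃ J ⊆ A, i ∈ J ∧ #J = 2 ^ m ∧ G.IsPlacedCopy s m J i r S := by
  classical
  have hr := h.root_mem
  obtain ⟨h, f, hinj, hf, rfl⟩ := h
  refine ⟨S.image f, image_subset_iff.2 fun x hx => (hf x hx).1, mem_image_of_mem f hr, ?_,
    h, f, hinj, fun x hx => ⟨mem_image_of_mem f hx, (hf x hx).2⟩, rfl⟩
  rw [card_image_of_injOn hinj, h.card_eq]

theorem zero (hr : r ∈ s i) (hi : i ∈ A) : G.IsPlacedCopy s 0 A i r {r} :=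
  ⟨rfl, fun _ => i, by simp, by simpa using ⟨hi, hr⟩, rfl⟩

open Classical in
theorem join [DecidableEq ι] (hs : Pairwise fun k l => Disjoint (s k) (s l)) {A' : Finset ι} {i' : ι} {r' : V}
    {S' : Finset V} (h : G.IsPlacedCopy s m A i r S) (h' : G.IsPlacedCopy s m A' i' r' S')
    (hA : Disjoint A A') (hadj : G.Adj r r')
    (hcross : ∀ x ∈ S, ∀ y ∈ S', G.Adj x y → x = r ∧ y = r') :
    G.IsPlacedCopy s (m + 1) (A ∪ A') i r (S ∪ S') := by
  have hr := h.root_mem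
  obtain ⟨h, f, hinj, hf, hfr⟩ := h
  obtain ⟨h', f', hinj', hf', -⟩ := h'
  have hne : ∀ x ∈ S, ∀ y ∈ S', f x ≠ f' y := fun x hx y hy he =>
    Finset.disjoint_left.1 hA (hf x hx).1 (he ▸ (hf' y hy).1)
  have hd : Disjoint S S' := Finset.disjoint_left.2 fun x hx hx' =>
    Finset.disjoint_left.1 (hs (hne x hx x hx')) (hf x hx).2 (hf' x hx').2
  have e : ∀ x ∈ S, (if x ∈ S then f x else f' x) = f x := fun x hx => if_pos hx
  have e' : ∀ x ∈ S', (if x ∈ S then f x else f' x) = f' x := fun x hx =>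
    if_neg fun hx' => Finset.disjoint_left.1 hd hx' hx
  refine ⟨⟨r', S, S', h, h', hd, rfl, hadj, hcross⟩, fun x => if x ∈ S then f x else f' x,
    ?_, ?_, ?_⟩
  · intro x hx y hy hxy
    rw [mem_coe, mem_union] at hx hy
    rcases hx with hx | hx <;> rcases hy with hy | hy
    · simp only [e x hx, e y hy] at hxy; exact hinj hx hy hxy
    · simp only [e x hx, e' y hy] at hxy; exact absurd hxy (hne x hx y hy)
    · simp only [e' x hx, e y hy] at hxy; exact absurd hxy.symm (hne y hy x hx)
    · simp only [e' x hx, e' y hy] at hxy; exact hinj' hx hy hxy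
  · intro x hx
    rcases mem_union.1 hx with hx | hx
    · simp only [e x hx]; exact ⟨mem_union_left _ (hf x hx).1, (hf x hx).2⟩
    · simp only [e' x hx]; exact ⟨mem_union_right _ (hf' x hx).1, (hf' x hx).2⟩
  · simp only [e r hr]; exact hfr

end IsPlacedCopy

open Classical in
/-- The set of vertices with a neighbour in `U`. -/
noncomputable def neighborsOf {V : Type*} [Fintype V] (G : SimpleGraph V) (U : Finset V) :
    Finset V := {x | ∃ u ∈ U, G.Adj u x}

theorem mem_neighborsOf {V : Type*} [Fintype V] {G : SimpleGraph V} {U : Finset V} {x : V} :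
    x ∈ G.neighborsOf U ↔ ∃ u ∈ U, G.Adj u x := by
  simp [neighborsOf]

end SimpleGraph

/-! ### Ultrafilter limits: thick sets, availability, aliveness and stability. -/

/-- Going down only destroys properties, so an element with the fewest of the finitely many
properties has none left to lose. -/
theorem exists_le_forall_stable {α κ : Type*} [Preorder α] [Finite κ] (P : κ → α → Prop)
    (hP : ∀ k a b, a ≤ b → P k a → P k b) (Q : α → Prop) (a : α) (ha : Q a) :
    ∃ b ≤ a, Q b ∧ ∀ c ≤ b, Q c → ∀ k, P k b → P k c := by
  have hne : {n | ∃ b ≤ a, Q b ∧ {k | P k b}.ncard = n}.Nonempty := ⟨_, a, le_rfl, ha, rfl⟩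
  obtain ⟨b, hb, hQb, hn⟩ := Nat.sInf_mem hne
  refine ⟨b, hb, hQb, fun c hc hQc k hk => ?_⟩
  have hle : {k | P k b}.ncard ≤ {k | P k c}.ncard := by
    rw [hn]
    exact Nat.sInf_le ⟨c, hc.trans hb, hQc, rfl⟩
  have heq := Set.eq_of_subset_of_ncard_le (s := {k | P k c}) (t := {k | P k b})
    (fun k hk => hP k c b hc hk) hle
  have : k ∈ {k | P k c} := heq ▸ hk
  exact this

namespace Asymptotic

universe u
variable {V : ℕ → Type u}

/-- Along `𝒰`, the sets `A n` have size at least a positive constant times `W n`. -/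
def IsThick (𝒰 : Ultrafilter ℕ) (W : ℕ → ℕ) (A : ∀ n, Finset (V n)) : Prop :=
  ∃ c : ℝ, 0 < c ∧ ∀ᶠ n in 𝒰, c * W n ≤ #(A n)

section IsThick
variable {𝒰 : Ultrafilter ℕ} {W : ℕ → ℕ} {A B : ∀ n, Finset (V n)}

theorem IsThick.mono (hA : IsThick 𝒰 W A) (h : ∀ n, A n ⊆ B n) : IsThick 𝒰 W B := by
  obtain ⟨c, hc, hA⟩ := hA
  exact ⟨c, hc, hA.mono fun n hn => hn.trans (by exact_mod_cast card_le_card (h n))⟩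

theorem IsThick.eventually_nonempty (hA : IsThick 𝒰 W A) (hW : ∀ᶠ n in 𝒰, 0 < W n) :
    ∀ᶠ n in 𝒰, (A n).Nonempty := by
  obtain ⟨c, hc, hA⟩ := hA
  filter_upwards [hA, hW] with n hn hW
  have : (0 : ℝ) < W n := by exact_mod_cast hW
  have : (0 : ℝ) < #(A n) := lt_of_lt_of_le (by positivity) hn
  exact card_pos.1 (by exact_mod_cast this)

theorem eventually_card_lt_of_not_isThick (hA : ¬ IsThick 𝒰 W A) {c : ℝ} (hc : 0 < c) :
    ∀ᶠ n in 𝒰, (#(A n) : ℝ) < c * W n := by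
  by_contra h
  rw [← Ultrafilter.eventually_not] at h
  exact hA ⟨c, hc, h.mono fun n hn => not_lt.1 hn⟩

theorem exists_uniform_of_forall_isThick {ι : Type*} [Finite ι] {s : ∀ n, ι → Finset (V n)}
    (hs : ∀ i, IsThick 𝒰 W fun n => s n i) :
    ∃ c : ℝ, 0 < c ∧ ∀ᶠ n in 𝒰, ∀ i, c * W n ≤ #(s n i) := by
  have := Fintype.ofFinite ι
  choose c hc h using hs
  rcases isEmpty_or_nonempty ι with hι | hι
  · exact ⟨1, one_pos, Filter.Eventually.of_forall fun n i => isEmptyElim i⟩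
  · refine ⟨univ.inf' univ_nonempty c, (lt_inf'_iff _).2 fun i _ => hc i,
      Filter.eventually_all.2 fun i => (h i).mono fun n hn => le_trans ?_ hn⟩
    exact mul_le_mul_of_nonneg_right (inf'_le _ (mem_univ i)) (Nat.cast_nonneg _)

end IsThick

/-- Binomial trees of order `m` placed in the blocks `A` with root in block `i` exist. -/
def IsAlive {ι : Type*} (𝒰 : Ultrafilter ℕ) (G : ∀ n, SimpleGraph (V n)) (s : ∀ n, ι → Finset (V n))
    (m : ℕ) (i : ι) (A : Finset ι) : Prop :=
  ∀ᶠ n in 𝒰, ∃ r S, (G n).IsPlacedCopy (s n) m A i r S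

theorem IsAlive.mono {ι : Type*} {𝒰 : Ultrafilter ℕ} {G : ∀ n, SimpleGraph (V n)}
    {s s' : ∀ n, ι → Finset (V n)} {m : ℕ} {i : ι} {A A' : Finset ι} (h : IsAlive 𝒰 G s m i A) (hs : s ≤ s')
    (hA : A ⊆ A') : IsAlive 𝒰 G s' m i A' :=
  Filter.Eventually.mono h fun n ⟨r, S, hS⟩ => ⟨r, S, hS.mono (hs n) hA⟩

variable [∀ n, Fintype (V n)]

open Classical in
/-- The asymptotic form of coherence. -/
structure IsCoherent (𝒰 : Ultrafilter ℕ) (W : ℕ → ℕ) (G : ∀ n, SimpleGraph (V n)) : Prop where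
  width_pos : ∀ᶠ n in 𝒰, 0 < W n
  degree_le : ∀ c : ℝ, 0 < c → ∀ᶠ n in 𝒰, ∀ v, (#{x | (G n).Adj v x} : ℝ) ≤ c * W n
  exists_adj : ∀ A B : ∀ n, Finset (V n), IsThick 𝒰 W A → IsThick 𝒰 W B →
    ∀ᶠ n in 𝒰, Disjoint (A n) (B n) → ∃ x ∈ A n, ∃ y ∈ B n, (G n).Adj x y

variable {ι : Type*}

open Classical in
/-- Some subset of block `i` has many neighbours in block `t`, and leaves a thick part of each
block `k ∈ K` without neighbours. -/
def IsAvailable (𝒰 : Ultrafilter ℕ) (W : ℕ → ℕ) (G : ∀ n, SimpleGraph (V n))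
    (s : ∀ n, ι → Finset (V n)) (i t : ι) (K : Finset ι) : Prop :=
  ∃ U : ∀ n, Finset (V n), (∀ n, U n ⊆ s n i) ∧
    IsThick 𝒰 W (fun n => s n t ∩ (G n).neighborsOf (U n)) ∧
    ∀ k ∈ K, IsThick 𝒰 W (fun n => s n k \ (G n).neighborsOf (U n))

/-- A thick system of blocks such that passing to thick subblocks does not change what is
available and alive. -/
structure IsStable (𝒰 : Ultrafilter ℕ) (W : ℕ → ℕ) (G : ∀ n, SimpleGraph (V n)) (h : ℕ)
    (s : ∀ n, ι → Finset (V n)) : Prop where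
  thick : ∀ i, IsThick 𝒰 W fun n => s n i
  available : ∀ s' ≤ s, (∀ i, IsThick 𝒰 W fun n => s' n i) → ∀ i t K,
    IsAvailable 𝒰 W G s i t K → IsAvailable 𝒰 W G s' i t K
  alive : ∀ s' ≤ s, (∀ i, IsThick 𝒰 W fun n => s' n i) → ∀ m ≤ h, ∀ i A,
    IsAlive 𝒰 G s m i A → IsAlive 𝒰 G s' m i A

variable {𝒰 : Ultrafilter ℕ} {W : ℕ → ℕ} {G : ∀ n, SimpleGraph (V n)}
  {s s' : ∀ n, ι → Finset (V n)}

theorem IsAvailable.mono {i t : ι} {K : Finset ι} (h : IsAvailable 𝒰 W G s i t K) (hs : s ≤ s') :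
    IsAvailable 𝒰 W G s' i t K := by
  classical
  obtain ⟨U, hU, ht, hK⟩ := h
  exact ⟨U, fun n => (hU n).trans (hs n i),
    ht.mono fun n => inter_subset_inter_right (hs n t),
    fun k hk => (hK k hk).mono fun n => sdiff_subset_sdiff (hs n k) subset_rfl⟩

theorem IsAvailable.anti {i t : ι} {K K' : Finset ι} (h : IsAvailable 𝒰 W G s i t K)
    (hK : K' ⊆ K) : IsAvailable 𝒰 W G s i t K' := by
  obtain ⟨U, hU, ht, h⟩ := h
  exact ⟨U, hU, ht, fun k hk => h k (hK hk)⟩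

theorem exists_isStable [Finite ι] (h : ℕ) (hs : ∀ i, IsThick 𝒰 W fun n => s n i) :
    ∃ s' ≤ s, IsStable 𝒰 W G h s' := by
  obtain ⟨s', hs', hQ, hst⟩ := exists_le_forall_stable
    (κ := (ι × ι × Finset ι) ⊕ (Fin (h + 1) × ι × Finset ι))
    (fun k s => Sum.elim (fun k => IsAvailable 𝒰 W G s k.1 k.2.1 k.2.2)
      (fun k => IsAlive 𝒰 G s k.1 k.2.1 k.2.2) k)
    (by
      rintro (k | k) a b hab hk
      · exact IsAvailable.mono hk hab
      · exact IsAlive.mono hk hab subset_rfl)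
    (fun s => ∀ i, IsThick 𝒰 W fun n => s n i) s hs
  exact ⟨s', hs', hQ, fun c hc hQc i t K => hst c hc hQc (Sum.inl (i, t, K)),
    fun c hc hQc m hm i A => hst c hc hQc (Sum.inr (⟨m, by omega⟩, i, A))⟩

end Asymptotic

/-! ### Building copies by doubling when everything is available. -/

namespace Asymptotic

universe u
variable {V : ℕ → Type u} [∀ n, Fintype (V n)] {ι : Type*}
  {𝒰 : Ultrafilter ℕ} {W : ℕ → ℕ} {G : ∀ n, SimpleGraph (V n)} {s₀ : ∀ n, ι → Finset (V n)}

open Classical in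
-- Copies of order m starting at x and at x' = x + 2 ^ m are joined through a set U in block x'
-- given by availability: block x is cut down to neighbours of U, and the outside blocks to
-- non-neighbours. That non-root vertices see nothing outside their own range makes the join induced
-- and is what the induction carries.
theorem exists_rooted_subsystem (hd : ∀ n, Pairwise fun k l => Disjoint (s₀ n k) (s₀ n l))
    {L : ℕ} {e : ℕ → ι} (he : Set.InjOn e (Set.Iio L))
    (hav : ∀ s ≤ s₀, (∀ i, IsThick 𝒰 W fun n => s n i) → ∀ t i, t < i → i < L →
      IsAvailable 𝒰 W G s (e i) (e t) ({k ∈ range L | k < t ∨ i < k}.image e)) (m : ℕ) :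
    ∀ x, x + 2 ^ m ≤ L → ∀ s ≤ s₀, (∀ i, IsThick 𝒰 W fun n => s n i) →
      ∃ s' ≤ s, (∀ i, IsThick 𝒰 W fun n => s' n i) ∧
        ∀ n, ∀ y ∈ s' n (e x), ∃ S,
          (G n).IsPlacedCopy (s n) m ((Ico x (x + 2 ^ m)).image e) (e x) y S ∧
          ∀ z ∈ S, z ≠ y → ∀ k < L, k < x ∨ x + 2 ^ m ≤ k → ∀ w ∈ s' n (e k),
            ¬ (G n).Adj z w := by
  induction m with
  | zero =>
    intro x hx s hs hthick
    refine ⟨s, le_rfl, hthick, fun n y hy => ⟨{y}, .zero hy (mem_image_of_mem e (by simp)), ?_⟩⟩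
    intro z hz hzy
    exact absurd (mem_singleton.1 hz) hzy
  | succ m ih =>
    intro x hx s hs hthick
    have hpow : 2 ^ (m + 1) = 2 ^ m + 2 ^ m := by ring
    have hpos : 0 < 2 ^ m := by positivity
    set x' := x + 2 ^ m with hx'
    have hend : x + 2 ^ (m + 1) = x' + 2 ^ m := by omega
    rw [hend] at hx ⊢
    obtain ⟨s₁, hs₁, ht₁, h₁⟩ := ih x (by omega) s hs hthick
    obtain ⟨s₂, hs₂, ht₂, h₂⟩ := ih x' hx s₁ (hs₁.trans hs) ht₁
    obtain ⟨U, hU, hUt, hUK⟩ := hav s₂ (hs₂.trans (hs₁.trans hs)) ht₂ x x' (by omega) (by omega)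
    set K : Finset ι := {k ∈ range L | k < x ∨ x' < k}.image e with hK
    -- Blocks strictly between x and x' need no shrinking: they lie in the range of the new copy,
    -- where nothing is asked of them.
    set s₃ : ∀ n, ι → Finset (V n) := fun n j =>
      if j = e x then s₂ n j ∩ (G n).neighborsOf (U n)
      else if j ∈ K then s₂ n j \ (G n).neighborsOf (U n) else s₂ n j with hs₃
    have hs₃x : ∀ n, s₃ n (e x) = s₂ n (e x) ∩ (G n).neighborsOf (U n) := fun n => if_pos rfl
    have hle : s₃ ≤ s₂ := by
      intro n j
      simp only [hs₃]
      split_ifs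
      · exact inter_subset_left
      · exact sdiff_subset
      · exact le_rfl
    have hs₃k : ∀ n, ∀ k < L, k < x ∨ x' < k →
        s₃ n (e k) ⊆ s₂ n (e k) \ (G n).neighborsOf (U n) := by
      intro n k hk hkx
      have hne : e k ≠ e x := fun h => by
        have := he hk (show x < L by omega) h
        omega
      have hmem : e k ∈ K := mem_image_of_mem e (by simpa using ⟨hk, hkx⟩)
      simp only [hs₃, if_neg hne, if_pos hmem]
      exact subset_rfl
    have ht₃ : ∀ i, IsThick 𝒰 W fun n => s₃ n i := by
      intro i
      by_cases hi : i = e x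
      · subst hi
        simpa only [hs₃x] using hUt
      · by_cases hiK : i ∈ K
        · simpa only [hs₃, if_neg hi, if_pos hiK] using hUK i hiK
        · simpa only [hs₃, if_neg hi, if_neg hiK] using ht₂ i
    refine ⟨s₃, hle.trans (hs₂.trans hs₁), ht₃, fun n y hy => ?_⟩
    rw [hs₃x, mem_inter, SimpleGraph.mem_neighborsOf] at hy
    obtain ⟨hy, u, hu, huy⟩ := hy
    have hu₂ := hU n hu
    obtain ⟨S, hS, hSa⟩ := h₁ n y (hs₂ n _ hy)
    obtain ⟨S', hS', hSa'⟩ := h₂ n u hu₂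
    have hdisj : Disjoint ((Ico x x').image e) ((Ico x' (x' + 2 ^ m)).image e) := by
      rw [Finset.disjoint_left]
      intro j hj hj'
      obtain ⟨a, ha, rfl⟩ := mem_image.1 hj
      obtain ⟨b, hb, hab⟩ := mem_image.1 hj'
      rw [mem_Ico] at ha hb
      have := he (show b < L by omega) (show a < L by omega) hab
      omega
    have hunion : (Ico x (x' + 2 ^ m)).image e =
        (Ico x x').image e ∪ (Ico x' (x' + 2 ^ m)).image e := by
      rw [← image_union, Ico_union_Ico_eq_Ico (by omega) (by omega)]
    have hds : Pairwise fun k l => Disjoint (s n k) (s n l) := fun k l hkl =>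
      (hd n hkl).mono (hs n k) (hs n l)
    have hcross : ∀ z ∈ S, ∀ w ∈ S', (G n).Adj z w → z = y ∧ w = u := by
      intro z hz w hw hzw
      have hzy : z = y := by
        by_contra hne
        obtain ⟨j, hj, hwj⟩ := hS'.exists_mem_block hw
        obtain ⟨k, hk, rfl⟩ := mem_image.1 hj
        rw [mem_Ico] at hk
        exact hSa z hz hne k (by omega) (by omega) w hwj hzw
      refine ⟨hzy, ?_⟩
      by_contra hne
      exact hSa' w hw hne x (by omega) (by omega) y hy (hzy ▸ hzw.symm)
    refine ⟨S ∪ S', ?_, ?_⟩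
    · rw [hunion]
      exact hS.join hds (hS'.mono (hs₁ n) subset_rfl) hdisj huy.symm hcross
    · intro z hz hzy k hk hkx w hw hzw
      have hw' := mem_sdiff.1 (hs₃k n k hk (by omega) hw)
      rcases mem_union.1 hz with hz | hz
      · exact hSa z hz hzy k hk (by omega) w (hs₂ n _ hw'.1) hzw
      · by_cases hzu : z = u
        · subst hzu
          exact hw'.2 (SimpleGraph.mem_neighborsOf.2 ⟨z, hu, hzw⟩)
        · exact hSa' z hz hzu k hk (by omega) w hw'.1 hzw

theorem exists_isPlacedCopy_of_isAvailable
    (hd : ∀ n, Pairwise fun k l => Disjoint (s₀ n k) (s₀ n l)) (hW : ∀ᶠ n in 𝒰, 0 < W n)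
    {h : ℕ} (hst : IsStable 𝒰 W G h s₀) [DecidableEq ι] {e : ℕ → ι}
    (he : Set.InjOn e (Set.Iio (2 ^ h)))
    (hav : ∀ t i, t < i → i < 2 ^ h →
      IsAvailable 𝒰 W G s₀ (e i) (e t) ({k ∈ range (2 ^ h) | k < t ∨ i < k}.image e)) :
    ∀ᶠ n in 𝒰, ∃ A i r S, (G n).IsPlacedCopy (s₀ n) h A i r S := by
  obtain ⟨s', -, ht, h'⟩ := exists_rooted_subsystem (m := h) hd he (fun s hs hs' t i hti hi => by
    convert hst.available s hs hs' _ _ _ (hav t i hti hi)) 0 (by omega) s₀ le_rfl hst.thick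
  filter_upwards [(ht (e 0)).eventually_nonempty hW] with n hn
  obtain ⟨y, hy⟩ := hn
  obtain ⟨S, hS, -⟩ := h' n y hy
  exact ⟨_, _, _, _, hS⟩

end Asymptotic

/-! ### Contracting trees: families of disjoint copies and their contacts. -/

open Classical in
-- Let q be a common median of #(R y); `hzero` forces q > 0. By `hhalf`, y above the median has #(R
-- y \ D y) ≥ q/2, and y below it has #(R y ∪ D y) ≤ 3q/2, which is the input of
-- `exists_covering_subset`. Two halvings, by the median and by the covering, give the factor 4.
theorem Finset.exists_contact_system {ι α τ : Type*} {I : Finset ι} (hI : I.Nonempty)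
    (S : ι → Finset α) (R D : α → Finset τ)
    (hhalf : ∀ k ∈ I, ∀ y ∈ S k, 2 * #(D y) ≤ #(R y))
    (hzero : ∀ k ∈ I, 2 * #{y ∈ S k | R y = ∅} < #(S k))
    (hdeg : ∀ t, ∀ k ∈ I, 48 * #I * #{y ∈ S k | t ∈ R y} ≤ #(S k)) :
    ∃ j ∈ I, ∃ C ⊆ S j, #(S j) ≤ 48 * #I * #C ∧ ∃ Z : ι → Finset α,
      (∀ k ∈ I, Z k ⊆ S k ∧ #(S k) ≤ 4 * #(Z k)) ∧ ∃ X : Finset τ,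
        (∀ y ∈ C, ∃ t ∈ X, t ∈ R y ∧ t ∉ D y) ∧
        ∀ k ∈ I, ∀ w ∈ Z k, ∀ t ∈ X, t ∉ R w ∧ t ∉ D w := by
  have hS : ∀ k ∈ I, (S k).Nonempty := fun k hk => card_pos.1 (by have := hzero k hk; omega)
  obtain ⟨j, hj, q, hjq, hk⟩ := exists_common_median hI S hS fun y => #(R y)
  have hq : 0 < q := by
    rcases Nat.eq_zero_or_pos q with rfl | h
    · have h₁ := hk j hj
      have h₂ := hzero j hj
      simp only [Nat.le_zero, card_eq_zero] at h₁
      omega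
    · exact h
  set Y : Finset α := {y ∈ S j | q ≤ #(R y)} with hY
  set Z : ι → Finset α := fun k => {y ∈ S k | #(R y) ≤ q} with hZ
  have hYne : Y.Nonempty := card_pos.1 (by have := card_pos.2 (hS j hj); omega)
  obtain ⟨X, -, hX₁, hX₂⟩ := exists_covering_subset hI Z hYne (Y.biUnion R)
    (fun y => R y \ D y) (fun y => R y ∪ D y) hq
    (fun y hy => sdiff_subset.trans (subset_biUnion_of_mem R hy))
    (by
      intro y hy
      rw [hY, mem_filter] at hy
      have := hhalf j hj y hy.1
      have := le_card_sdiff (D y) (R y)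
      omega)
    (by
      intro k hk y hy
      rw [hZ, mem_filter] at hy
      have := hhalf k hk y hy.1
      have := card_union_le (R y) (D y)
      omega)
    (by
      intro t _
      have h₁ := hdeg t j hj
      have h₂ : #{y ∈ Y | t ∈ R y \ D y} ≤ #{y ∈ S j | t ∈ R y} := by
        refine card_le_card fun y hy => ?_
        rw [mem_filter, hY, mem_filter, mem_sdiff] at hy
        exact mem_filter.2 ⟨hy.1.1, hy.2.1⟩
      have h₃ := Nat.mul_le_mul_left (24 * #I) h₂
      have h₄ : 48 * #I * #{y ∈ S j | t ∈ R y} = 2 * (24 * #I * #{y ∈ S j | t ∈ R y}) := by ring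
      omega)
  refine ⟨j, hj, {y ∈ Y | ∃ t ∈ X, t ∈ R y \ D y},
    (filter_subset _ _).trans (filter_subset _ _), ?_,
    fun k => Z k \ {y ∈ Z k | ∃ t ∈ X, t ∈ R y ∪ D y}, fun k hkI => ⟨?_, ?_⟩, X, ?_, ?_⟩
  · have : 48 * #I * #{y ∈ Y | ∃ t ∈ X, t ∈ R y \ D y} =
        2 * (24 * #I * #{y ∈ Y | ∃ t ∈ X, t ∈ R y \ D y}) := by ring
    omega
  · exact sdiff_subset.trans (filter_subset _ _)
  · have h₁ := hk k hkI
    have h₂ := hX₂ k hkI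
    rw [card_sdiff_of_subset (filter_subset _ _)]
    change #(S k) ≤ 2 * #(Z k) at h₁
    omega
  · intro y hy
    obtain ⟨t, ht, hty⟩ := (mem_filter.1 hy).2
    exact ⟨t, ht, mem_sdiff.1 hty⟩
  · intro k _ w hw t ht
    obtain ⟨hw, hn⟩ := mem_sdiff.1 hw
    rw [← not_or, ← mem_union]
    exact fun h => hn (mem_filter.2 ⟨hw, t, ht, h⟩)

namespace Asymptotic

universe u
variable {V : ℕ → Type u} [∀ n, Fintype (V n)] {ι : Type*}
  {𝒰 : Ultrafilter ℕ} {W : ℕ → ℕ} {G : ∀ n, SimpleGraph (V n)} {s : ∀ n, ι → Finset (V n)}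

open Classical in
-- A largest disjoint family has size of order W: otherwise deleting its vertices, 2 ^ m per copy,
-- would leave thick blocks, and stability would find one more copy there.
theorem IsStable.exists_disjoint_family {h : ℕ} [Finite ι] (hst : IsStable 𝒰 W G h s)
    {m : ℕ} (hm : m ≤ h) {i : ι} {A : Finset ι} (hal : IsAlive 𝒰 G s m i A) :
    ∃ F : ∀ n, Finset (V n × Finset (V n)),
      (∃ c : ℝ, 0 < c ∧ ∀ᶠ n in 𝒰, c * W n ≤ #(F n)) ∧
      ∀ n, (∀ p ∈ F n, (G n).IsPlacedCopy (s n) m A i p.1 p.2) ∧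
        ∀ p ∈ F n, ∀ q ∈ F n, p ≠ q → Disjoint p.2 q.2 := by
  set P : ∀ n, Finset (V n × Finset (V n)) → Prop := fun n F =>
    (∀ p ∈ F, (G n).IsPlacedCopy (s n) m A i p.1 p.2) ∧
      ∀ p ∈ F, ∀ q ∈ F, p ≠ q → Disjoint p.2 q.2 with hP
  have hex : ∀ n, ∃ F, P n F ∧ ∀ F', P n F' → #F' ≤ #F := by
    intro n
    obtain ⟨F, hF, hmax⟩ := exists_max_image (univ.filter (P n)) card ⟨∅, by simp [hP]⟩
    exact ⟨F, (mem_filter.1 hF).2, fun F' hF' => hmax F' (mem_filter.2 ⟨mem_univ _, hF'⟩)⟩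
  choose F hF hmax using hex
  refine ⟨F, ?_, hF⟩
  by_contra hnot
  obtain ⟨c, hc, hcs⟩ := exists_uniform_of_forall_isThick hst.thick
  set δ : ℝ := c / 2 / 2 ^ m with hδ
  have hδpos : 0 < δ := by positivity
  have hsmall : ∀ᶠ n in 𝒰, (#(F n) : ℝ) < δ * W n := by
    by_contra h'
    rw [← Ultrafilter.eventually_not] at h'
    exact hnot ⟨δ, hδpos, h'.mono fun n hn => not_lt.1 hn⟩
  set s' : ∀ n, ι → Finset (V n) := fun n k => s n k \ (F n).biUnion Prod.snd with hs'
  have hle : s' ≤ s := fun n k => sdiff_subset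
  have hthick : ∀ k, IsThick 𝒰 W fun n => s' n k := by
    refine fun k => ⟨c / 2, by positivity, ?_⟩
    filter_upwards [hcs, hsmall] with n h₁ h₂
    have h₃ : #((F n).biUnion Prod.snd) ≤ #(F n) * 2 ^ m :=
      card_biUnion_le_card_mul _ _ _ fun p hp => ((hF n).1 p hp).1.card_eq.le
    have h₄ : #(s n k) ≤ #(s' n k) + #((F n).biUnion Prod.snd) := by
      have := le_card_sdiff ((F n).biUnion Prod.snd) (s n k)
      simp only [hs']
      omega
    have h₅ : (#(s n k) : ℝ) ≤ #(s' n k) + #((F n).biUnion Prod.snd) := by exact_mod_cast h₄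
    have h₆ : (#((F n).biUnion Prod.snd) : ℝ) ≤ #(F n) * 2 ^ m := by exact_mod_cast h₃
    have h₇ : (#(F n) : ℝ) * 2 ^ m ≤ c / 2 * W n := by
      have : (#(F n) : ℝ) * 2 ^ m ≤ δ * W n * 2 ^ m :=
        mul_le_mul_of_nonneg_right h₂.le (by positivity)
      refine this.trans (le_of_eq ?_)
      rw [hδ]; field_simp
    linarith [h₁ k]
  obtain ⟨n, r, S, hS⟩ := (hst.alive s' hle hthick m hm i A hal).exists
  have hdisj : ∀ p ∈ F n, Disjoint S p.2 := fun p hp => Finset.disjoint_left.2 fun x hx hx' => by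
    obtain ⟨k, -, hk⟩ := hS.exists_mem_block hx
    exact (mem_sdiff.1 hk).2 (mem_biUnion.2 ⟨p, hp, hx'⟩)
  have hnotin : (r, S) ∉ F n := fun hmem =>
    Finset.disjoint_left.1 (hdisj _ hmem) hS.root_mem hS.root_mem
  have hlarge := hmax n (insert (r, S) (F n)) ⟨?_, ?_⟩
  · rw [card_insert_of_notMem hnotin] at hlarge
    omega
  · intro p hp
    rcases mem_insert.1 hp with rfl | hp
    · exact hS.mono (hle n) subset_rfl
    · exact (hF n).1 p hp
  · intro p hp p' hp' hne
    rcases mem_insert.1 hp with rfl | hp <;> rcases mem_insert.1 hp' with rfl | hp'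
    · exact absurd rfl hne
    · exact hdisj p' hp'
    · exact (hdisj p hp).symm
    · exact (hF n).2 p hp p' hp' hne

end Asymptotic

namespace SimpleGraph

variable {V ι : Type*}

open Classical in
/-- The disjoint union of the families `F e`, `e ∈ E`. -/
noncomputable def taggedUnion [Fintype V] (E : Finset ι) (F : ι → Finset (V × Finset V)) :
    Finset (ι × V × Finset V) := {p ∈ E ×ˢ univ | p.2 ∈ F p.1}

open Classical in
/-- The trees of the family `Ω` whose root is adjacent to `y`. -/
noncomputable def rootContacts (G : SimpleGraph V) (Ω : Finset (ι × V × Finset V)) (y : V) :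
    Finset (ι × V × Finset V) := {p ∈ Ω | G.Adj p.2.1 y}

open Classical in
/-- The trees of the family `Ω` with a vertex other than the root adjacent to `y`. -/
noncomputable def bodyContacts (G : SimpleGraph V) (Ω : Finset (ι × V × Finset V)) (y : V) :
    Finset (ι × V × Finset V) := {p ∈ Ω | ∃ z ∈ p.2.2, z ≠ p.2.1 ∧ G.Adj z y}

theorem mem_taggedUnion [Fintype V] {E : Finset ι} {F : ι → Finset (V × Finset V)}
    {p : ι × V × Finset V} : p ∈ taggedUnion E F ↔ p.1 ∈ E ∧ p.2 ∈ F p.1 := by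
  simp [taggedUnion]

theorem mem_rootContacts {G : SimpleGraph V} {Ω : Finset (ι × V × Finset V)} {y : V}
    {p : ι × V × Finset V} : p ∈ G.rootContacts Ω y ↔ p ∈ Ω ∧ G.Adj p.2.1 y := by
  simp [rootContacts]

theorem mem_bodyContacts {G : SimpleGraph V} {Ω : Finset (ι × V × Finset V)} {y : V}
    {p : ι × V × Finset V} :
    p ∈ G.bodyContacts Ω y ↔ p ∈ Ω ∧ ∃ z ∈ p.2.2, z ≠ p.2.1 ∧ G.Adj z y := by
  simp [bodyContacts]

/-- Send a tree to its tag and one of its vertices in X; trees with equal tags are disjoint, so no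
pair is used twice. -/
theorem card_le_of_forall_exists_mem [Fintype V] {E : Finset ι} {F : ι → Finset (V × Finset V)}
    (hF : ∀ e ∈ E, ∀ p ∈ F e, ∀ q ∈ F e, p ≠ q → Disjoint p.2 q.2) {X : Finset V}
    {Ω : Finset (ι × V × Finset V)} (hΩ : Ω ⊆ taggedUnion E F)
    (h : ∀ p ∈ Ω, ∃ z ∈ p.2.2, z ∈ X) : #Ω ≤ #E * #X := by
  classical
  rw [← card_product]
  refine card_le_card_of_forall_subsingleton (fun p q => p.1 = q.1 ∧ q.2 ∈ p.2.2) ?_ ?_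
  · intro p hp
    obtain ⟨z, hz, hzX⟩ := h p hp
    exact ⟨(p.1, z), mem_product.2 ⟨(mem_taggedUnion.1 (hΩ hp)).1, hzX⟩, rfl, hz⟩
  · rintro ⟨e, z⟩ - p ⟨hp, rfl, hz⟩ q ⟨hq, hpq, hz'⟩
    have hp' := mem_taggedUnion.1 (hΩ hp)
    have hq' := mem_taggedUnion.1 (hΩ hq)
    have hpq : q.1 = p.1 := hpq
    refine Prod.ext hpq.symm ?_
    by_contra hne
    rw [hpq] at hq'
    exact Finset.disjoint_left.1 (hF p.1 hp'.1 _ hp'.2 _ hq'.2 hne) hz hz'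

end SimpleGraph

namespace SimpleGraph

variable {V ι : Type*} [Fintype V] {G : SimpleGraph V} {s : ι → Finset V} {E : Finset ι}
  {F : ι → Finset (V × Finset V)}

open Classical in
theorem card_bodyContacts_le
    (hF : ∀ e ∈ E, ∀ p ∈ F e, ∀ q ∈ F e, p ≠ q → Disjoint p.2 q.2) (y : V) :
    #(G.bodyContacts (taggedUnion E F) y) ≤ #E * #{x | G.Adj y x} := by
  refine card_le_of_forall_exists_mem hF (fun p hp => (mem_bodyContacts.1 hp).1) fun p hp => ?_
  obtain ⟨z, hz, -, hzy⟩ := (mem_bodyContacts.1 hp).2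
  exact ⟨z, hz, mem_filter.2 ⟨mem_univ _, hzy.symm⟩⟩

open Classical in
-- A tree at e either has its root outside the neighbourhood of U', and disjoint trees have distinct
-- roots, or is a root contact of U.
theorem card_le_card_sdiff_neighborsOf_add {e : ι} (he : e ∈ E)
    (hF : ∀ p ∈ F e, ∀ q ∈ F e, p ≠ q → Disjoint p.2 q.2)
    (hroot : ∀ p ∈ F e, p.1 ∈ p.2 ∧ p.1 ∈ s e) {U U' : Finset V} (hU : U' ⊆ U) :
    #(F e) ≤ #(s e \ G.neighborsOf U') +
      #(U.biUnion (G.rootContacts (taggedUnion E F))) := by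
  rw [← card_filter_add_card_filter_not (s := F e) (fun p => p.1 ∉ G.neighborsOf U')]
  refine add_le_add (card_le_card_of_injOn Prod.fst ?_ ?_)
    (card_le_card_of_injOn (fun p => (e, p)) ?_ ?_)
  · intro p hp
    rw [mem_coe, mem_filter] at hp
    exact mem_sdiff.2 ⟨(hroot p hp.1).2, hp.2⟩
  · intro p hp q hq hpq
    rw [mem_coe, mem_filter] at hp hq
    by_contra hne
    exact Finset.disjoint_left.1 (hF p hp.1 q hq.1 hne) (hroot p hp.1).1
      (hpq ▸ (hroot q hq.1).1)
  · intro p hp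
    rw [mem_coe, mem_filter, not_not, mem_neighborsOf] at hp
    obtain ⟨hp, u, hu, hup⟩ := hp
    exact mem_biUnion.2 ⟨u, hU hu, mem_rootContacts.2
      ⟨mem_taggedUnion.2 ⟨he, hp⟩, hup.symm⟩⟩
  · intro p _ q _ hpq
    exact (Prod.ext_iff.1 hpq).2

open Classical in
-- Pigeonhole over pairs of blocks: every body contact yields a non-root vertex in some block k with
-- a neighbour in U ∩ s j, and one vertex accounts for at most #E trees.
theorem exists_card_inter_neighborsOf [Fintype ι]
    (hF : ∀ e ∈ E, ∀ p ∈ F e, ∀ q ∈ F e, p ≠ q → Disjoint p.2 q.2) {A : ι → Finset ι}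
    (hA : ∀ e ∈ E, ∀ p ∈ F e, ∀ z ∈ p.2, z ≠ p.1 → ∃ k ∈ A e, k ≠ e ∧ z ∈ s k)
    {I : Finset ι} {U : Finset V} (hU : U ⊆ I.biUnion s) {θ : ℝ} (hθ : 0 < θ)
    (hUθ : #E * (Fintype.card ι * Fintype.card ι) * θ <
      #(U.biUnion (G.bodyContacts (taggedUnion E F)))) :
    ∃ q : ι × ι, q.1 ∈ I ∧ (∃ e ∈ E, q.2 ∈ A e ∧ q.2 ≠ e) ∧
      θ ≤ #(s q.2 ∩ G.neighborsOf (U ∩ s q.1)) := by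
  by_contra! hall
  set Q : Finset (ι × ι) := {q | q.1 ∈ I ∧ ∃ e ∈ E, q.2 ∈ A e ∧ q.2 ≠ e} with hQ
  set X : Finset V := Q.biUnion fun q => s q.2 ∩ G.neighborsOf (U ∩ s q.1) with hX
  have h₁ : #(U.biUnion (G.bodyContacts (taggedUnion E F))) ≤ #E * #X := by
    refine card_le_of_forall_exists_mem hF ?_ ?_
    · intro p hp
      obtain ⟨u, -, hp⟩ := mem_biUnion.1 hp
      exact (mem_bodyContacts.1 hp).1
    · intro p hp
      obtain ⟨u, hu, hp⟩ := mem_biUnion.1 hp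
      obtain ⟨hp, z, hz, hzr, hzu⟩ := mem_bodyContacts.1 hp
      obtain ⟨he, hp⟩ := mem_taggedUnion.1 hp
      obtain ⟨k, hk, hke, hzk⟩ := hA _ he _ hp z hz hzr
      obtain ⟨j, hj, huj⟩ := mem_biUnion.1 (hU hu)
      exact ⟨z, hz, mem_biUnion.2 ⟨(j, k), mem_filter.2 ⟨mem_univ _, hj, _, he, hk, hke⟩,
        mem_inter.2 ⟨hzk, mem_neighborsOf.2 ⟨u, mem_inter.2 ⟨hu, huj⟩, hzu.symm⟩⟩⟩⟩
  have h₂ : (#X : ℝ) ≤ #Q * θ := by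
    have : (#X : ℝ) ≤ ∑ q ∈ Q, (#(s q.2 ∩ G.neighborsOf (U ∩ s q.1)) : ℝ) := by
      exact_mod_cast card_biUnion_le
    refine this.trans ?_
    rw [← nsmul_eq_mul]
    refine sum_le_card_nsmul _ _ _ fun q hq => ?_
    rw [hQ, mem_filter] at hq
    obtain ⟨-, hqI, e, he, hqe⟩ := hq
    exact (hall q hqI ⟨e, he, hqe⟩).le
  have h₃ : (#Q : ℝ) ≤ Fintype.card ι * Fintype.card ι := by
    have : #Q ≤ Fintype.card (ι × ι) := card_le_univ Q
    rw [Fintype.card_prod] at this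
    exact_mod_cast this
  have h₄ : (#(U.biUnion (G.bodyContacts (taggedUnion E F))) : ℝ) ≤ #E * #X := by
    exact_mod_cast h₁
  have h₅ : (#X : ℝ) ≤ Fintype.card ι * Fintype.card ι * θ :=
    h₂.trans (mul_le_mul_of_nonneg_right h₃ hθ.le)
  have h₆ := mul_le_mul_of_nonneg_left h₅ (Nat.cast_nonneg (α := ℝ) #E)
  linarith

end SimpleGraph

namespace Asymptotic

universe u
variable {V : ℕ → Type u} [∀ n, Fintype (V n)] {ι : Type*}
  {𝒰 : Ultrafilter ℕ} {W : ℕ → ℕ} {G : ∀ n, SimpleGraph (V n)} {s : ∀ n, ι → Finset (V n)}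

open Classical SimpleGraph in
-- Saturate with R the root contacts and D the body contacts. If the saturated set U reached θ W
-- body contacts, then U ∩ s j would reach a thick part of some block v and, having few root
-- contacts, miss thick sets of roots in all of E, against `hnav`. So U and the trees it meets in
-- their bodies can be discarded; the remaining vertices have at most half as many body as root
-- contacts, and coherence gives most of them a root contact. `exists_contact_system` then selects
-- the trees.
theorem IsStable.exists_contraction [Fintype ι] {h : ℕ} (hG : IsCoherent 𝒰 W G)
    (hd : ∀ n, Pairwise fun k l => Disjoint (s n k) (s n l)) (hst : IsStable 𝒰 W G h s)
    {I E : Finset ι} (hI : I.Nonempty) (hE : E.Nonempty) (hIE : Disjoint I E) {m : ι → ℕ}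
    {A : ι → Finset ι} (hm : ∀ e ∈ E, m e ≤ h) (hal : ∀ e ∈ E, IsAlive 𝒰 G s (m e) e (A e))
    (hnav : ∀ j ∈ I, ∀ e ∈ E, ∀ v ∈ A e, v ≠ e → ¬ IsAvailable 𝒰 W G s j v E) :
    ∃ c : ℝ, 0 < c ∧ ∀ᶠ n in 𝒰, ∃ j ∈ I, ∃ C ⊆ s n j, c * W n ≤ #C ∧
      ∃ Z : ι → Finset (V n), (∀ k ∈ I, Z k ⊆ s n k ∧ c * W n ≤ #(Z k)) ∧
        ∀ y ∈ C, ∃ e ∈ E, ∃ r S, (G n).IsPlacedCopy (s n) (m e) (A e) e r S ∧ (G n).Adj r y ∧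
          (∀ z ∈ S, (G n).Adj z y → z = r) ∧
          ∀ k ∈ I, ∀ w ∈ Z k, ∀ z ∈ S, ¬ (G n).Adj z w := by
  have hfam : ∀ e, ∃ F : ∀ n, Finset (V n × Finset (V n)), e ∈ E →
      (∃ c : ℝ, 0 < c ∧ ∀ᶠ n in 𝒰, c * W n ≤ #(F n)) ∧
      ∀ n, (∀ p ∈ F n, (G n).IsPlacedCopy (s n) (m e) (A e) e p.1 p.2) ∧
        ∀ p ∈ F n, ∀ q ∈ F n, p ≠ q → Disjoint p.2 q.2 := by
    intro e
    by_cases he : e ∈ E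
    · obtain ⟨F, hF⟩ := hst.exists_disjoint_family (hm e he) (hal e he)
      exact ⟨F, fun _ => hF⟩
    · exact ⟨fun _ => ∅, fun he' => absurd he' he⟩
  choose F hF using hfam
  have hdis : ∀ n, ∀ e ∈ E, ∀ p ∈ F e n, ∀ q ∈ F e n, p ≠ q → Disjoint p.2 q.2 :=
    fun n e he => ((hF e he).2 n).2
  have hcopy : ∀ n, ∀ e ∈ E, ∀ p ∈ F e n, (G n).IsPlacedCopy (s n) (m e) (A e) e p.1 p.2 :=
    fun n e he => ((hF e he).2 n).1
  obtain ⟨c₀, hc₀, hs₀⟩ := exists_uniform_of_forall_isThick hst.thick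
  obtain ⟨c₁, hc₁, hs₁⟩ := exists_uniform_of_forall_isThick
    (V := fun n => V n × Finset (V n)) (ι := E) (s := fun n e => F e n)
    (fun e => (hF e e.2).1)
  have hIpos : (0 : ℝ) < #I := by exact_mod_cast card_pos.2 hI
  have hEpos : (0 : ℝ) < #E := by exact_mod_cast card_pos.2 hE
  have hιpos : (0 : ℝ) < Fintype.card ι := by
    exact_mod_cast Fintype.card_pos_iff.2 ⟨hI.choose⟩
  -- c₀ / 2 leaves half of each block after deleting U. With at most 2θ W body contacts, U has at
  -- most 6θ W contacts of either kind, and c₁ / 12 makes this half a family.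
  set θ : ℝ := min (c₀ / 2) (c₁ / 12) with hθdef
  have hθ : 0 < θ := by positivity
  have hθ₀ : θ ≤ c₀ / 2 := min_le_left _ _
  have hθ₁ : θ ≤ c₁ / 12 := min_le_right _ _
  -- The first term limits the body contacts of one vertex to θ W; the second gives the degree
  -- condition of `exists_contact_system`.
  set δ : ℝ := min (θ / #E) (c₀ / (96 * #I)) with hδdef
  have hδ : 0 < δ := by positivity
  have hδE : #E * δ ≤ θ := by
    have := mul_le_mul_of_nonneg_left (min_le_left (θ / #E) (c₀ / (96 * #I))) hEpos.le
    rwa [mul_div_cancel₀ _ hEpos.ne'] at this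
  have hδI : 48 * #I * δ ≤ c₀ / 2 := by
    have := mul_le_mul_of_nonneg_left (min_le_right (θ / #E) (c₀ / (96 * #I)))
      (show (0 : ℝ) ≤ 48 * #I by positivity)
    refine this.trans (le_of_eq ?_)
    field_simp
    norm_num
  set Ω : ∀ n, Finset (ι × V n × Finset (V n)) := fun n => taggedUnion E fun e => F e n with hΩ
  set R : ∀ n, V n → Finset (ι × V n × Finset (V n)) := fun n => (G n).rootContacts (Ω n)
  set D : ∀ n, V n → Finset (ι × V n × Finset (V n)) := fun n => (G n).bodyContacts (Ω n)
  set B : ∀ n, Finset (V n) → Finset (ι × V n × Finset (V n)) := fun n U => U.biUnion (D n)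
    with hB
  have hgood : ∀ᶠ n in 𝒰, 0 < W n ∧ (∀ i, c₀ * W n ≤ #(s n i)) ∧
      (∀ e ∈ E, c₁ * W n ≤ #(F e n)) ∧
      ∀ v, (#{x | (G n).Adj v x} : ℝ) ≤ δ * W n := by
    filter_upwards [hG.width_pos, hs₀, hs₁, hG.degree_le δ hδ] with n h₁ h₂ h₃ h₄
    exact ⟨h₁, h₂, fun e he => h₃ ⟨e, he⟩, h₄⟩
  have hsat : ∀ n, ∃ U : Finset (V n), (0 < W n ∧ (∀ i, c₀ * W n ≤ #(s n i)) ∧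
      (∀ e ∈ E, c₁ * W n ≤ #(F e n)) ∧ ∀ v, (#{x | (G n).Adj v x} : ℝ) ≤ δ * W n) →
      U ⊆ I.biUnion (s n) ∧ #U ≤ #(B n U) ∧
      #(U.biUnion (R n) \ B n U) ≤ 2 * #(B n U) ∧
      (θ * W n ≤ #(B n U) ∧ (#(B n U) : ℝ) ≤ θ * W n + θ * W n ∨
        (#(B n U) : ℝ) < θ * W n ∧ ∀ y ∈ I.biUnion (s n), y ∉ U →
          2 * #(D n y \ B n U) ≤ #(R n y \ B n U)) := by
    intro n
    by_cases hn : 0 < W n ∧ (∀ i, c₀ * W n ≤ #(s n i)) ∧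
      (∀ e ∈ E, c₁ * W n ≤ #(F e n)) ∧ ∀ v, (#{x | (G n).Adj v x} : ℝ) ≤ δ * W n
    · obtain ⟨hW, -, -, hdeg⟩ := hn
      have hW' : (0 : ℝ) < W n := by exact_mod_cast hW
      obtain ⟨U, hU⟩ := exists_saturated_subset (I.biUnion (s n)) (R n) (D n)
        (θ := θ * W n) (Δ := θ * W n) (by positivity) (by
          intro y _
          have h₁ : (#(D n y) : ℝ) ≤ #E * #{x | (G n).Adj y x} := by
            exact_mod_cast card_bodyContacts_le (hdis n) y
          have h₂ := mul_le_mul_of_nonneg_left (hdeg y) hEpos.le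
          have h₃ := mul_le_mul_of_nonneg_right hδE hW'.le
          linarith)
      exact ⟨U, fun _ => by convert hU⟩
    · exact ⟨∅, fun hn' => absurd hn' hn⟩
  choose U hU using hsat
  have hsecond : ∀ᶠ n in 𝒰, (#(B n (U n)) : ℝ) < θ * W n ∧
      ∀ y ∈ I.biUnion (s n), y ∉ U n →
        2 * #(D n y \ B n (U n)) ≤ #(R n y \ B n (U n)) := by
    by_contra hnot
    rw [← Ultrafilter.eventually_not] at hnot
    have hfirst : ∀ᶠ n in 𝒰, θ * W n ≤ #(B n (U n)) ∧
        (#(B n (U n)) : ℝ) ≤ θ * W n + θ * W n := by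
      filter_upwards [hgood, hnot] with n hn hn'
      exact (hU n hn).2.2.2.resolve_right hn'
    -- The factor 2 makes the pigeonhole inequality strict.
    set c₂ : ℝ := θ / (2 * (#E * (Fintype.card ι * Fintype.card ι))) with hc₂
    have hc₂pos : 0 < c₂ := by positivity
    have hpig : ∀ᶠ n in 𝒰, ∃ q : ι × ι, q.1 ∈ I ∧ (∃ e ∈ E, q.2 ∈ A e ∧ q.2 ≠ e) ∧
        c₂ * W n ≤ #(s n q.2 ∩ (G n).neighborsOf (U n ∩ s n q.1)) := by
      filter_upwards [hgood, hfirst] with n hn hn'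
      have hW' : (0 : ℝ) < W n := by exact_mod_cast hn.1
      refine exists_card_inter_neighborsOf (hdis n)
        (fun e he p hp z hz hzr => (hcopy n e he p hp).exists_ne_mem_block hz hzr)
        (hU n hn).1 (by positivity) (lt_of_lt_of_le ?_ hn'.1)
      have : #E * (Fintype.card ι * Fintype.card ι) * (c₂ * W n) = θ * W n / 2 := by
        rw [hc₂]; field_simp
      rw [this]
      have : 0 < θ * W n := by positivity
      linarith
    obtain ⟨⟨j, v⟩, hq⟩ := Ultrafilter.eventually_exists_iff.1 hpig
    obtain ⟨n₀, hj, ⟨e, he, hv, hve⟩, -⟩ := hq.exists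
    refine hnav j hj e he v hv hve ⟨fun n => U n ∩ s n j, fun n => inter_subset_right,
      ⟨c₂, hc₂pos, hq.mono fun n hn => ?_⟩, fun e' he' => ⟨c₁ / 2, by positivity, ?_⟩⟩
    · exact hn.2.2
    · filter_upwards [hgood, hfirst] with n hn hn'
      have h₁ : #(F e' n) ≤ #(s n e' \ (G n).neighborsOf (U n ∩ s n j)) +
          #((U n).biUnion (R n)) :=
        card_le_card_sdiff_neighborsOf_add (F := fun e => F e n) (G := G n) (s := s n) he'
          (hdis n e' he')
          (fun p hp => ⟨(hcopy n e' he' p hp).root_mem, (hcopy n e' he' p hp).root_mem_block⟩)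
          inter_subset_left
      have h₂ : #((U n).biUnion (R n)) ≤ 3 * #(B n (U n)) := by
        have := le_card_sdiff (B n (U n)) ((U n).biUnion (R n))
        have := (hU n hn).2.2.1
        omega
      have h₃ : (#(F e' n) : ℝ) ≤ #(s n e' \ (G n).neighborsOf (U n ∩ s n j)) +
          3 * #(B n (U n)) := by
        exact_mod_cast h₁.trans (Nat.add_le_add_left h₂ _)
      have h₄ := hn.2.2.1 e' he'
      have h₅ := mul_le_mul_of_nonneg_right hθ₁ (Nat.cast_nonneg (α := ℝ) (W n))
      linarith [hn'.2]
  have hsize : ∀ᶠ n in 𝒰, ∀ k, c₀ / 2 * W n ≤ #(s n k \ U n) := by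
    filter_upwards [hgood, hsecond] with n hn hn' k
    have h₁ := le_card_sdiff (U n) (s n k)
    have h₂ := (hU n hn).2.1
    have h₃ : #(s n k) ≤ #(s n k \ U n) + #(B n (U n)) := by omega
    have h₄ : (#(s n k) : ℝ) ≤ #(s n k \ U n) + #(B n (U n)) := by exact_mod_cast h₃
    have h₅ := mul_le_mul_of_nonneg_right hθ₀ (Nat.cast_nonneg (α := ℝ) (W n))
    linarith [hn.2.1 k, hn'.1]
  have hzero : ∀ᶠ n in 𝒰, ∀ k ∈ I,
      2 * #{y ∈ s n k \ U n | R n y \ B n (U n) = ∅} < #(s n k \ U n) := by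
    rw [Filter.eventually_all_finset]
    intro k hk
    obtain ⟨e, he⟩ := hE
    -- Roots in block e of the surviving trees. Vertices without surviving root contact have no
    -- neighbour in this thick set, so by coherence they are not thick.
    set T : ∀ n, Finset (V n) := fun n =>
      {p ∈ F e n | (e, p) ∉ B n (U n)}.image Prod.fst with hT
    have hTthick : IsThick 𝒰 W T := by
      refine ⟨c₁ / 2, by positivity, ?_⟩
      filter_upwards [hgood, hsecond] with n hn hn'
      have h₁ : #(T n) = #{p ∈ F e n | (e, p) ∉ B n (U n)} := by
        refine card_image_of_injOn fun p hp q hq hpq => ?_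
        rw [mem_coe, mem_filter] at hp hq
        by_contra hne
        exact Finset.disjoint_left.1 (hdis n e he p hp.1 q hq.1 hne)
          (hcopy n e he p hp.1).root_mem (hpq ▸ (hcopy n e he q hq.1).root_mem)
      have h₂ : #{p ∈ F e n | ¬ (e, p) ∉ B n (U n)} ≤ #(B n (U n)) :=
        card_le_card_of_injOn (fun p => (e, p))
          (fun p hp => not_not.1 (mem_filter.1 hp).2) (fun p _ q _ hpq => (Prod.ext_iff.1 hpq).2)
      have h₃ := card_filter_add_card_filter_not (s := F e n) (fun p => (e, p) ∉ B n (U n))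
      have h₄ : #(F e n) ≤ #(T n) + #(B n (U n)) := by omega
      have h₅ : (#(F e n) : ℝ) ≤ #(T n) + #(B n (U n)) := by exact_mod_cast h₄
      have h₆ := mul_le_mul_of_nonneg_right hθ₁ (Nat.cast_nonneg (α := ℝ) (W n))
      have h₇ := hn.2.2.1 e he
      have h₈ : 0 ≤ c₁ * W n := by positivity
      linarith [hn'.1]
    have hnot : ¬ IsThick 𝒰 W fun n => {y ∈ s n k \ U n | R n y \ B n (U n) = ∅} := by
      intro hthick
      obtain ⟨n, hn⟩ := (hG.exists_adj _ _ hthick hTthick).exists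
      have hke : k ≠ e := fun h => Finset.disjoint_left.1 hIE hk (h ▸ he)
      obtain ⟨y, hy, r, hr, hyr⟩ := hn (by
        refine (hd n hke).mono ((filter_subset _ _).trans sdiff_subset) fun r hr => ?_
        obtain ⟨p, hp, rfl⟩ := mem_image.1 hr
        exact (hcopy n e he p (mem_filter.1 hp).1).root_mem_block)
      obtain ⟨p, hp, rfl⟩ := mem_image.1 hr
      rw [mem_filter] at hp
      have hmem : (e, p) ∈ R n y \ B n (U n) := mem_sdiff.2 ⟨mem_rootContacts.2
        ⟨mem_taggedUnion.2 ⟨he, hp.1⟩, hyr.symm⟩, hp.2⟩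
      rw [(mem_filter.1 hy).2] at hmem
      exact notMem_empty _ hmem
    filter_upwards [hsize, eventually_card_lt_of_not_isThick hnot
      (show 0 < c₀ / 4 by positivity)] with n h₁ h₂
    have h₃ : (2 * #{y ∈ s n k \ U n | R n y \ B n (U n) = ∅} : ℝ) < #(s n k \ U n) := by
      linarith [h₁ k]
    exact_mod_cast h₃
  refine ⟨c₀ / (96 * #I), by positivity, ?_⟩
  filter_upwards [hgood, hsecond, hsize, hzero] with n hn hn₁ hn₂ hn₃
  have hWn : (0 : ℝ) ≤ W n := Nat.cast_nonneg _
  obtain ⟨j, hj, C, hC, hCc, Z, hZ, X, hX₁, hX₂⟩ := exists_contact_system hI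
    (fun k => s n k \ U n) (fun y => R n y \ B n (U n)) (fun y => D n y \ B n (U n))
    (fun k hk y hy => hn₁.2 y (mem_biUnion.2 ⟨k, hk, (mem_sdiff.1 hy).1⟩) (mem_sdiff.1 hy).2)
    (fun k hk => by convert hn₃ k hk) (by
      intro t k hk
      have h₁ : (#{y ∈ s n k \ U n | t ∈ R n y \ B n (U n)} : ℝ) ≤ δ * W n := by
        refine le_trans ?_ (hn.2.2.2 t.2.1)
        refine Nat.cast_le.2 (card_le_card fun y hy => ?_)
        exact mem_filter.2 ⟨mem_univ _,
          (mem_rootContacts.1 (mem_sdiff.1 (mem_filter.1 hy).2).1).2⟩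
      have h₂ := mul_le_mul_of_nonneg_left h₁ (show (0 : ℝ) ≤ 48 * #I by positivity)
      have h₃ := mul_le_mul_of_nonneg_right hδI hWn
      have h₄ : (48 * #I * #{y ∈ s n k \ U n | t ∈ R n y \ B n (U n)} : ℝ) ≤
          #(s n k \ U n) := by linarith [hn₂ k]
      have h₅ : 48 * #I * #{y ∈ s n k \ U n | t ∈ R n y \ B n (U n)} ≤ #(s n k \ U n) := by
        exact_mod_cast h₄
      convert h₅)
  have hI1 : (1 : ℝ) ≤ #I := by exact_mod_cast card_pos.2 hI
  refine ⟨j, hj, C, hC.trans sdiff_subset, ?_, Z, fun k hk => ⟨(hZ k hk).1.trans sdiff_subset, ?_⟩,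
    fun y hy => ?_⟩
  · have h₁ : (#(s n j \ U n) : ℝ) ≤ 48 * #I * #C := by exact_mod_cast hCc
    rw [div_mul_eq_mul_div, div_le_iff₀ (by positivity)]
    linarith [hn₂ j]
  · have h₁ : (#(s n k \ U n) : ℝ) ≤ 4 * #(Z k) := by exact_mod_cast (hZ k hk).2
    have h₂ : c₀ / (96 * #I) ≤ c₀ / 8 := div_le_div_of_nonneg_left hc₀.le (by norm_num)
      (by linarith)
    have h₃ := mul_le_mul_of_nonneg_right h₂ hWn
    linarith [hn₂ k]
  · obtain ⟨t, htX, htR, htD⟩ := hX₁ y hy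
    obtain ⟨htR, htB⟩ := mem_sdiff.1 htR
    obtain ⟨htΩ, hty⟩ := mem_rootContacts.1 htR
    obtain ⟨hte, htF⟩ := mem_taggedUnion.1 htΩ
    refine ⟨t.1, hte, t.2.1, t.2.2, hcopy n _ hte _ htF, hty, ?_, ?_⟩
    · intro z hz hzy
      by_contra hzr
      exact htD (mem_sdiff.2 ⟨mem_bodyContacts.2 ⟨htΩ, z, hz, hzr, hzy⟩, htB⟩)
    · intro k hk w hw z hz hzw
      obtain ⟨h₁, h₂⟩ := hX₂ k hk w hw t htX
      by_cases hzr : z = t.2.1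
      · exact h₁ (mem_sdiff.2 ⟨mem_rootContacts.2 ⟨htΩ, hzr ▸ hzw⟩, htB⟩)
      · exact h₂ (mem_sdiff.2 ⟨mem_bodyContacts.2 ⟨htΩ, z, hz, hzr, hzw⟩, htB⟩)

end Asymptotic

/-! ### Order patterns of indices: copies from availability, and dead orders. -/

/-- The increasing enumeration of `g` elements in the middle of `Y`, with room on both sides. -/
theorem Finset.exists_middle_enumeration {ι : Type*} [LinearOrder ι] {Y : Finset ι} {g : ℕ}
    (hg : 0 < g) (hY : 3 * g ≤ #Y) :
    ∃ e : ℕ → ι, StrictMonoOn e (Set.Iio g) ∧ (∀ k < g, e k ∈ Y) ∧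
      ∀ t i, t < i → i < g → ∃ E₁ ⊆ Y, ∃ E₂ ⊆ Y, #E₁ = g ∧ #E₂ = g ∧
        (∀ x ∈ E₁, x < e t) ∧ (∀ x ∈ E₂, e i < x) ∧
        ∀ k < g, (k < t → e k ∈ E₁) ∧ (i < k → e k ∈ E₂) := by
  obtain ⟨Y₁, hY₁, Z, hZ, hc₁, hcZ, hlt₁⟩ := exists_initial_split Y g (by omega)
  obtain ⟨J, hJ, Y₂, hY₂, hcJ, hc₂, hlt₂⟩ := exists_initial_split Z g (by omega)
  set f := J.orderEmbOfFin hcJ with hf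
  set e : ℕ → ι := fun k => if hk : k < g then f ⟨k, hk⟩ else f ⟨0, hg⟩ with he
  have hef : ∀ k (hk : k < g), e k = f ⟨k, hk⟩ := fun k hk => dif_pos hk
  have hmono : StrictMonoOn e (Set.Iio g) := by
    intro k hk l hl hkl
    rw [hef k hk, hef l hl]
    exact f.strictMono hkl
  have heJ : ∀ k < g, e k ∈ J := fun k hk => by
    rw [hef k hk]; exact J.orderEmbOfFin_mem hcJ _
  refine ⟨e, hmono, fun k hk => hZ (hJ (heJ k hk)), fun t i hti hi => ?_⟩
  have ht : t < g := hti.trans hi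
  -- The earlier terms are padded to exactly g elements below e t, the size for which availability
  -- is known.
  obtain ⟨E₁, h₁, h₁', hE₁⟩ := exists_subsuperset_card_eq (s := (range t).image e)
    (t := {y ∈ Y | y < e t}) (n := g)
    (by
      intro x hx
      obtain ⟨k, hk, rfl⟩ := mem_image.1 hx
      have hkt := mem_range.1 hk
      exact mem_filter.2 ⟨hZ (hJ (heJ k (by omega))), hmono (hkt.trans ht) ht hkt⟩)
    (card_image_le.trans (by rw [card_range]; omega))
    (by
      rw [← hc₁]
      exact card_le_card fun x hx => mem_filter.2 ⟨hY₁ hx, hlt₁ x hx _ (hJ (heJ t ht))⟩)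
  obtain ⟨E₂, h₂, h₂', hE₂⟩ := exists_subsuperset_card_eq (s := (Ioo i g).image e)
    (t := {y ∈ Y | e i < y}) (n := g)
    (by
      intro x hx
      obtain ⟨k, hk, rfl⟩ := mem_image.1 hx
      have hk := mem_Ioo.1 hk
      exact mem_filter.2 ⟨hZ (hJ (heJ k hk.2)), hmono hi hk.2 hk.1⟩)
    (card_image_le.trans (by rw [Nat.card_Ioo]; omega))
    (by
      have : g ≤ #Y₂ := by omega
      refine this.trans (card_le_card fun x hx =>
        mem_filter.2 ⟨hZ (hY₂ hx), hlt₂ _ (heJ i hi) x hx⟩))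
  refine ⟨E₁, h₁'.trans (filter_subset _ _), E₂, h₂'.trans (filter_subset _ _), hE₁, hE₂,
    fun x hx => (mem_filter.1 (h₁' hx)).2, fun x hx => (mem_filter.1 (h₂' hx)).2,
    fun k hk => ⟨fun hkt => h₁ (mem_image_of_mem e (mem_range.2 hkt)),
      fun hik => h₂ (mem_image_of_mem e (mem_Ioo.2 ⟨hik, hk⟩))⟩⟩

namespace SimpleGraph.IsPlacedCopy

variable {V ι : Type*} {G : SimpleGraph V} {s : ι → Finset V}

/-- Two copies joined only by an edge between the roots give a larger one, rooted at either. -/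
theorem join_le [DecidableEq ι] (hs : Pairwise fun k l => Disjoint (s k) (s l)) {m₁ m₂ m : ℕ} {A₁ A₂ : Finset ι}
    {e j : ι} {r y : V} {S T : Finset V} (h₁ : G.IsPlacedCopy s m₁ A₁ e r S)
    (h₂ : G.IsPlacedCopy s m₂ A₂ j y T) (hm₁ : m ≤ m₁) (hm₂ : m ≤ m₂) (hA : Disjoint A₁ A₂)
    (hadj : G.Adj r y) (hcross : ∀ x ∈ S, ∀ w ∈ T, G.Adj x w → x = r ∧ w = y) :
    (∃ S', G.IsPlacedCopy s (m + 1) (A₁ ∪ A₂) e r S') ∧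
      ∃ S', G.IsPlacedCopy s (m + 1) (A₁ ∪ A₂) j y S' := by
  classical
  obtain ⟨S', hS', h₁'⟩ := h₁.exists_subset hm₁
  obtain ⟨T', hT', h₂'⟩ := h₂.exists_subset hm₂
  refine ⟨⟨_, h₁'.join hs h₂' hA hadj fun x hx w hw => hcross x (hS' hx) w (hT' hw)⟩, ?_⟩
  rw [union_comm]
  exact ⟨_, h₂'.join hs h₁' hA.symm hadj.symm fun w hw x hx hwx =>
    (hcross x (hS' hx) w (hT' hw) hwx.symm).symm⟩

end SimpleGraph.IsPlacedCopy

namespace Asymptotic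

universe u
variable {V : ℕ → Type u} {ι : Type*} [LinearOrder ι]
  {𝒰 : Ultrafilter ℕ} {W : ℕ → ℕ} {G : ∀ n, SimpleGraph (V n)} {s : ∀ n, ι → Finset (V n)}
  {h : ℕ} {Y : Finset ι}

theorem IsStable.exists_isPlacedCopy_of_isAvailable_left [∀ n, Fintype (V n)]
    (hd : ∀ n, Pairwise fun k l => Disjoint (s n k) (s n l)) (hW : ∀ᶠ n in 𝒰, 0 < W n)
    (hst : IsStable 𝒰 W G h s) (hY : 3 * 2 ^ h ≤ #Y)
    (hav : ∀ E₁ ⊆ Y, ∀ E₂ ⊆ Y, ∀ t ∈ Y, ∀ i ∈ Y, #E₁ = 2 ^ h → #E₂ = 2 ^ h →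
      (∀ x ∈ E₁, x < t) → t < i → (∀ x ∈ E₂, i < x) → IsAvailable 𝒰 W G s i t (E₁ ∪ E₂)) :
    ∀ᶠ n in 𝒰, ∃ A i r S, (G n).IsPlacedCopy (s n) h A i r S := by
  obtain ⟨e, hmono, heY, he⟩ := exists_middle_enumeration (by positivity) hY
  refine exists_isPlacedCopy_of_isAvailable hd hW hst hmono.injOn fun t i hti hi => ?_
  obtain ⟨E₁, h₁, E₂, h₂, hc₁, hc₂, hlt₁, hlt₂, hK⟩ := he t i hti hi
  refine (hav E₁ h₁ E₂ h₂ _ (heY t (hti.trans hi)) _ (heY i hi) hc₁ hc₂ hlt₁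
    (hmono (hti.trans hi) hi hti) hlt₂).anti fun x hx => ?_
  obtain ⟨k, hk, rfl⟩ := mem_image.1 hx
  obtain ⟨hk, hkk⟩ := mem_filter.1 hk
  obtain ⟨hl, hr⟩ := hK k (mem_range.1 hk)
  exact mem_union.2 (hkk.imp hl hr)

/-- The enumeration is read backwards, which exchanges the roles of t and i. -/
theorem IsStable.exists_isPlacedCopy_of_isAvailable_right [∀ n, Fintype (V n)]
    (hd : ∀ n, Pairwise fun k l => Disjoint (s n k) (s n l)) (hW : ∀ᶠ n in 𝒰, 0 < W n)
    (hst : IsStable 𝒰 W G h s) (hY : 3 * 2 ^ h ≤ #Y)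
    (hav : ∀ E₁ ⊆ Y, ∀ E₂ ⊆ Y, ∀ t ∈ Y, ∀ i ∈ Y, #E₁ = 2 ^ h → #E₂ = 2 ^ h →
      (∀ x ∈ E₁, x < t) → t < i → (∀ x ∈ E₂, i < x) → IsAvailable 𝒰 W G s t i (E₁ ∪ E₂)) :
    ∀ᶠ n in 𝒰, ∃ A i r S, (G n).IsPlacedCopy (s n) h A i r S := by
  obtain ⟨e, hmono, heY, he⟩ := exists_middle_enumeration (by positivity) hY
  have hlt : ∀ k, 2 ^ h - 1 - k < 2 ^ h := fun k => by
    have : 0 < 2 ^ h := by positivity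
    omega
  refine exists_isPlacedCopy_of_isAvailable (e := fun k => e (2 ^ h - 1 - k)) hd hW hst
    (fun k hk l hl hkl => ?_) fun t i hti hi => ?_
  · have := hmono.injOn (hlt k) (hlt l) hkl
    rw [Set.mem_Iio] at hk hl
    omega
  · obtain ⟨E₁, h₁, E₂, h₂, hc₁, hc₂, hlt₁, hlt₂, hK⟩ :=
      he (2 ^ h - 1 - i) (2 ^ h - 1 - t) (by omega) (hlt t)
    refine (hav E₁ h₁ E₂ h₂ _ (heY _ (hlt i)) _ (heY _ (hlt t)) hc₁ hc₂ hlt₁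
      (hmono (hlt i) (hlt t) (by omega)) hlt₂).anti fun x hx => ?_
    obtain ⟨k, hk, rfl⟩ := mem_image.1 hx
    obtain ⟨hk, hkk⟩ := mem_filter.1 hk
    rw [mem_range] at hk
    obtain ⟨hl, hr⟩ := hK (2 ^ h - 1 - k) (hlt k)
    exact mem_union.2 (hkk.symm.imp (fun h => hl (by omega)) (fun h => hr (by omega)))

/-- A copy of order m ≤ h meets only 2 ^ m blocks, so its index set can be padded above i to exactly
2 ^ h elements, where `hdead` applies; there are only finitely many such sets. -/
theorem eventually_not_isPlacedCopy_min [Finite ι] {m : ℕ} (hm : m ≤ h)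
    (hdead : ∀ A ⊆ Y, #A = 2 ^ h → ∀ i ∈ A, (∀ x ∈ A, i ≤ x) → ¬ IsAlive 𝒰 G s m i A) :
    ∀ᶠ n in 𝒰, ∀ A ⊆ Y, ∀ i, (∀ x ∈ A, i ≤ x) → 2 ^ h ≤ #{y ∈ Y | i ≤ y} → ∀ r S,
      ¬ (G n).IsPlacedCopy (s n) m A i r S := by
  have hno : ∀ᶠ n in 𝒰, ∀ A i, A ⊆ Y ∧ #A = 2 ^ h ∧ i ∈ A ∧ (∀ x ∈ A, i ≤ x) → ∀ r S,
      ¬ (G n).IsPlacedCopy (s n) m A i r S := by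
    refine Filter.eventually_all.2 fun A => Filter.eventually_all.2 fun i => ?_
    by_cases hA : A ⊆ Y ∧ #A = 2 ^ h ∧ i ∈ A ∧ (∀ x ∈ A, i ≤ x)
    · refine (Ultrafilter.eventually_not.2 (hdead A hA.1 hA.2.1 i hA.2.2.1 hA.2.2.2)).mono ?_
      exact fun n hn _ r S hS => hn ⟨r, S, hS⟩
    · exact Filter.Eventually.of_forall fun n hA' => absurd hA' hA
  refine hno.mono fun n hn A hA i hi hc r S hS => ?_
  obtain ⟨J, hJA, hiJ, hJc, hSJ⟩ := hS.exists_index_subset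
  obtain ⟨A', hJA', hA', hc'⟩ := exists_subsuperset_card_eq (s := J) (t := {y ∈ Y | i ≤ y})
    (fun x hx => mem_filter.2 ⟨hA (hJA hx), hi x (hJA hx)⟩)
    (hJc.le.trans (Nat.pow_le_pow_right two_pos hm)) hc
  exact hn A' i ⟨hA'.trans (filter_subset _ _), hc', hJA' hiJ,
    fun x hx => (mem_filter.1 (hA' hx)).2⟩ r S (hSJ.mono le_rfl hJA')

theorem eventually_not_isPlacedCopy_max [Finite ι] {m : ℕ} (hm : m ≤ h)
    (hdead : ∀ A ⊆ Y, #A = 2 ^ h → ∀ i ∈ A, (∀ x ∈ A, x ≤ i) → ¬ IsAlive 𝒰 G s m i A) :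
    ∀ᶠ n in 𝒰, ∀ A ⊆ Y, ∀ i, (∀ x ∈ A, x ≤ i) → 2 ^ h ≤ #{y ∈ Y | y ≤ i} → ∀ r S,
      ¬ (G n).IsPlacedCopy (s n) m A i r S :=
  eventually_not_isPlacedCopy_min (ι := ιᵒᵈ) hm hdead

end Asymptotic

/-! ### The contradiction when nothing is available. -/

namespace Asymptotic

universe u
variable {V : ℕ → Type u} [∀ n, Fintype (V n)] {ι : Type*} [LinearOrder ι] [Fintype ι]
  {𝒰 : Ultrafilter ℕ} {W : ℕ → ℕ} {G : ∀ n, SimpleGraph (V n)} {s : ∀ n, ι → Finset (V n)}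
  {h : ℕ} {Y : Finset ι}

/-- A thick subsystem in which the block `j` consists of vertices attached to trees rooted in the
blocks of `E`, and the other blocks of `I` have no edges to these trees. -/
theorem IsStable.exists_contracted_system (hG : IsCoherent 𝒰 W G)
    (hd : ∀ n, Pairwise fun k l => Disjoint (s n k) (s n l)) (hst : IsStable 𝒰 W G h s)
    {I E : Finset ι} (hI : I.Nonempty) (hE : E.Nonempty) (hIE : Disjoint I E) {m : ι → ℕ}
    {A : ι → Finset ι} (hm : ∀ e ∈ E, m e ≤ h) (hal : ∀ e ∈ E, IsAlive 𝒰 G s (m e) e (A e))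
    (hnav : ∀ j ∈ I, ∀ e ∈ E, ∀ v ∈ A e, v ≠ e → ¬ IsAvailable 𝒰 W G s j v E) :
    ∃ j ∈ I, ∃ s' ≤ s, (∀ i, IsThick 𝒰 W fun n => s' n i) ∧
      ∀ᶠ n in 𝒰, ∀ y ∈ s' n j, ∃ e ∈ E, ∃ r S,
        (G n).IsPlacedCopy (s n) (m e) (A e) e r S ∧ (G n).Adj r y ∧
          (∀ z ∈ S, (G n).Adj z y → z = r) ∧
          ∀ k ∈ I, k ≠ j → ∀ w ∈ s' n k, ∀ z ∈ S, ¬ (G n).Adj z w := by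
  classical
  obtain ⟨c, hc, hev⟩ := hst.exists_contraction hG hd hI hE hIE hm hal hnav
  obtain ⟨j, hj⟩ := Ultrafilter.eventually_exists_iff.1 hev
  obtain ⟨-, hjI, -⟩ := hj.exists
  have hsys : ∀ n, ∃ t ≤ s n, (∀ k ∉ I, t k = s n k) ∧
      ((j ∈ I ∧ ∃ C ⊆ s n j, c * W n ≤ #C ∧
      ∃ Z : ι → Finset (V n), (∀ k ∈ I, Z k ⊆ s n k ∧ c * W n ≤ #(Z k)) ∧
        ∀ y ∈ C, ∃ e ∈ E, ∃ r S, (G n).IsPlacedCopy (s n) (m e) (A e) e r S ∧ (G n).Adj r y ∧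
          (∀ z ∈ S, (G n).Adj z y → z = r) ∧
          ∀ k ∈ I, ∀ w ∈ Z k, ∀ z ∈ S, ¬ (G n).Adj z w) →
      (∀ k ∈ I, c * W n ≤ #(t k)) ∧ ∀ y ∈ t j, ∃ e ∈ E, ∃ r S,
        (G n).IsPlacedCopy (s n) (m e) (A e) e r S ∧ (G n).Adj r y ∧
          (∀ z ∈ S, (G n).Adj z y → z = r) ∧
          ∀ k ∈ I, k ≠ j → ∀ w ∈ t k, ∀ z ∈ S, ¬ (G n).Adj z w) := by
    intro n
    by_cases hn : j ∈ I ∧ ∃ C ⊆ s n j, c * W n ≤ #C ∧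
      ∃ Z : ι → Finset (V n), (∀ k ∈ I, Z k ⊆ s n k ∧ c * W n ≤ #(Z k)) ∧
        ∀ y ∈ C, ∃ e ∈ E, ∃ r S, (G n).IsPlacedCopy (s n) (m e) (A e) e r S ∧ (G n).Adj r y ∧
          (∀ z ∈ S, (G n).Adj z y → z = r) ∧
          ∀ k ∈ I, ∀ w ∈ Z k, ∀ z ∈ S, ¬ (G n).Adj z w
    · obtain ⟨-, C, hC, hCc, Z, hZ, hy⟩ := hn
      set t : ι → Finset (V n) := fun k => if k = j then C else if k ∈ I then Z k else s n k
        with ht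
      have htj : t j = C := if_pos rfl
      have htk : ∀ k ∈ I, k ≠ j → t k = Z k := fun k hk hkj => by
        simp only [ht, if_neg hkj, if_pos hk]
      have htI : ∀ k ∉ I, t k = s n k := fun k hk => by
        have hkj : k ≠ j := fun h => hk (h ▸ hjI)
        simp only [ht, if_neg hkj, if_neg hk]
      refine ⟨t, fun k => ?_, htI, fun _ => ⟨fun k hk => ?_, fun y hyt => ?_⟩⟩
      · by_cases hkj : k = j
        · rw [hkj, htj]; exact hC
        · by_cases hk : k ∈ I
          · rw [htk k hk hkj]; exact (hZ k hk).1
          · rw [htI k hk]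
      · by_cases hkj : k = j
        · rw [hkj, htj]; exact hCc
        · rw [htk k hk hkj]; exact (hZ k hk).2
      · rw [htj] at hyt
        obtain ⟨e, he, r, S, h₁, h₂, h₃, h₄⟩ := hy y hyt
        exact ⟨e, he, r, S, h₁, h₂, h₃, fun k hk hkj w hw => h₄ k hk w (htk k hk hkj ▸ hw)⟩
    · exact ⟨s n, le_rfl, fun _ _ => rfl, fun hn' => absurd hn' hn⟩
  choose s' hs' hsI hs'n using hsys
  refine ⟨j, hjI, s', hs', fun i => ?_, ?_⟩
  · by_cases hi : i ∈ I
    · exact ⟨c, hc, hj.mono fun n hn => (hs'n n hn).1 i hi⟩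
    · simpa only [hsI _ i hi] using hst.thick i
  · exact hj.mono fun n hn => (hs'n n hn).2

theorem IsStable.false_of_not_isAvailable (hG : IsCoherent 𝒰 W G)
    (hd : ∀ n, Pairwise fun k l => Disjoint (s n k) (s n l)) (hst : IsStable 𝒰 W G h s)
    (hY : 6 * 2 ^ h ≤ #Y)
    (hleft : ∀ E₁ ⊆ Y, ∀ E₂ ⊆ Y, ∀ t ∈ Y, ∀ i ∈ Y, #E₁ = 2 ^ h → #E₂ = 2 ^ h →
      (∀ x ∈ E₁, x < t) → t < i → (∀ x ∈ E₂, i < x) → ¬ IsAvailable 𝒰 W G s i t (E₁ ∪ E₂))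
    (hright : ∀ E₁ ⊆ Y, ∀ E₂ ⊆ Y, ∀ t ∈ Y, ∀ i ∈ Y, #E₁ = 2 ^ h → #E₂ = 2 ^ h →
      (∀ x ∈ E₁, x < t) → t < i → (∀ x ∈ E₂, i < x) → ¬ IsAvailable 𝒰 W G s t i (E₁ ∪ E₂))
    {a b : ℕ} (ha : a < h) (hb : b < h)
    (hmin : ∀ A ⊆ Y, #A = 2 ^ h → ∀ i ∈ A, (∀ x ∈ A, i ≤ x) → IsAlive 𝒰 G s a i A)
    (hmax : ∀ A ⊆ Y, #A = 2 ^ h → ∀ i ∈ A, (∀ x ∈ A, x ≤ i) → IsAlive 𝒰 G s b i A)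
    (hmin' : ∀ A ⊆ Y, #A = 2 ^ h → ∀ i ∈ A, (∀ x ∈ A, i ≤ x) → ¬ IsAlive 𝒰 G s (a + 1) i A)
    (hmax' : ∀ A ⊆ Y, #A = 2 ^ h → ∀ i ∈ A, (∀ x ∈ A, x ≤ i) → ¬ IsAlive 𝒰 G s (b + 1) i A) :
    False := by
  classical
  set g := 2 ^ h with hg
  have hgpos : 0 < g := by positivity
  obtain ⟨E₁, hE₁, Y₁, hY₁, cE₁, cY₁, lE₁⟩ := exists_initial_split Y g (by omega)
  obtain ⟨V₁, hV₁, Y₂, hY₂, cV₁, cY₂, lV₁⟩ := exists_initial_split Y₁ (g - 1) (by omega)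
  obtain ⟨I, hI, Y₃, hY₃, cI, cY₃, lI⟩ := exists_initial_split Y₂ (2 * g) (by omega)
  obtain ⟨V₂, hV₂, Y₄, hY₄, cV₂, cY₄, lV₂⟩ := exists_initial_split Y₃ (g - 1) (by omega)
  obtain ⟨E₂, hE₂, cE₂⟩ := exists_subset_card_eq (s := Y₄) (n := g) (by omega)
  replace lE₂ : ∀ x ∈ V₂, ∀ y ∈ E₂, x < y := fun x hx y hy => lV₂ x hx y (hE₂ hy)
  have sI : I ⊆ Y₁ := hI.trans hY₂
  have sV₂ : V₂ ⊆ Y₂ := hV₂.trans hY₃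
  have sE₂ : E₂ ⊆ Y₃ := hE₂.trans hY₄
  have sE₂' : E₂ ⊆ Y₂ := sE₂.trans hY₃
  have yV₁ : V₁ ⊆ Y := hV₁.trans hY₁
  have yI : I ⊆ Y := sI.trans hY₁
  have yV₂ : V₂ ⊆ Y := (sV₂.trans hY₂).trans hY₁
  have yE₂ : E₂ ⊆ Y := (sE₂'.trans hY₂).trans hY₁
  set E := E₁ ∪ E₂ with hE
  have hEE : ∀ e ∈ E₂, e ∉ E₁ := fun e he he' =>
    lt_irrefl e (lE₁ e he' e (hY₂ (sE₂' he)))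
  set m : ι → ℕ := fun e => if e ∈ E₁ then a else b with hm
  set A : ι → Finset ι := fun e => if e ∈ E₁ then insert e V₁ else insert e V₂ with hA
  have m₁ : ∀ e ∈ E₁, m e = a := fun e he => if_pos he
  have m₂ : ∀ e ∈ E₂, m e = b := fun e he => if_neg (hEE e he)
  have A₁ : ∀ e ∈ E₁, A e = insert e V₁ := fun e he => if_pos he
  have A₂ : ∀ e ∈ E₂, A e = insert e V₂ := fun e he => if_neg (hEE e he)
  have oV₁ : ∀ e ∈ E₁, ∀ x ∈ V₁, e < x := fun e he x hx => lE₁ e he x (hV₁ hx)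
  obtain ⟨j, hj, s', hs', hthick, hev⟩ := hst.exists_contracted_system hG hd
    (I := I) (E := E) (m := m) (A := A) (card_pos.1 (by omega))
    ((card_pos.1 (by omega : 0 < #E₁)).mono subset_union_left)
    (by
      refine Finset.disjoint_left.2 fun x hx hxE => ?_
      rcases mem_union.1 hxE with hxE | hxE
      · exact lt_irrefl x (lE₁ x hxE x (sI hx))
      · exact lt_irrefl x (lI x hx x (sE₂ hxE)))
    (by
      intro e he
      rcases mem_union.1 he with he | he
      · rw [m₁ e he]; exact ha.le
      · rw [m₂ e he]; exact hb.le)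
    (by
      intro e he
      rcases mem_union.1 he with he | he
      · rw [m₁ e he, A₁ e he]
        refine hmin _ (insert_subset (hE₁ he) yV₁) ?_ e (mem_insert_self _ _) ?_
        · rw [card_insert_of_notMem fun h => lt_irrefl e (oV₁ e he e h)]
          omega
        · intro x hx
          rcases mem_insert.1 hx with rfl | hx
          · exact le_rfl
          · exact (oV₁ e he x hx).le
      · rw [m₂ e he, A₂ e he]
        refine hmax _ (insert_subset (yE₂ he) yV₂) ?_ e (mem_insert_self _ _) ?_
        · rw [card_insert_of_notMem fun h => lt_irrefl e (lE₂ e h e he)]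
          omega
        · intro x hx
          rcases mem_insert.1 hx with rfl | hx
          · exact le_rfl
          · exact (lE₂ x hx e he).le)
    (by
      intro j hj e he v hv hve
      rcases mem_union.1 he with he | he
      · rw [A₁ e he] at hv
        have hv := (mem_insert.1 hv).resolve_left hve
        exact hleft E₁ hE₁ E₂ yE₂ v (yV₁ hv) j (yI hj) cE₁ cE₂ (fun x hx => oV₁ x hx v hv)
          (lV₁ v hv j (hI hj)) (fun x hx => lI j hj x (sE₂ hx))
      · rw [A₂ e he] at hv
        have hv := (mem_insert.1 hv).resolve_left hve
        exact hright E₁ hE₁ E₂ yE₂ j (yI hj) v (yV₂ hv) cE₁ cE₂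
          (fun x hx => lE₁ x hx j (sI hj)) (lI j hj v (hV₂ hv)) (fun x hx => lE₂ v hv x hx))
  have nmin := eventually_not_isPlacedCopy_min (Nat.succ_le_of_lt ha) hmin'
  have nmax := eventually_not_isPlacedCopy_max (Nat.succ_le_of_lt hb) hmax'
  have cross : ∀ n y r (S : Finset (V n)) m₂ (A₂ : Finset ι) T, (∀ z ∈ S, (G n).Adj z y → z = r) →
      (∀ k ∈ I, k ≠ j → ∀ w ∈ s' n k, ∀ z ∈ S, ¬ (G n).Adj z w) → A₂ ⊆ I →
      (G n).IsPlacedCopy (s' n) m₂ A₂ j y T →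
      ∀ x ∈ S, ∀ w ∈ T, (G n).Adj x w → x = r ∧ w = y := by
    intro n y r S m₂ A₂ T h₁ h₂ hAI hT x hx w hw hxw
    have hwy : w = y := by
      by_contra hne
      obtain ⟨k, hk, hkj, hwk⟩ := hT.exists_ne_mem_block hw hne
      exact h₂ k (hAI hk) hkj w hwk x hx hxw
    exact ⟨h₁ x hx (hwy ▸ hxw), hwy⟩
  have dis : ∀ e ∈ E, ∀ A₂ ⊆ I, Disjoint (A e) A₂ := by
    intro e he A' hA'
    refine Finset.disjoint_left.2 fun x hx hx' => ?_
    have hxI := hA' hx'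
    rcases mem_union.1 he with he | he
    · rw [A₁ e he] at hx
      rcases mem_insert.1 hx with rfl | hx
      · exact lt_irrefl x (lE₁ x he x (sI hxI))
      · exact lt_irrefl x (lV₁ x hx x (hI hxI))
    · rw [A₂ e he] at hx
      rcases mem_insert.1 hx with rfl | hx
      · exact lt_irrefl x (lI x hxI x (sE₂ he))
      · exact lt_irrefl x (lI x hxI x (hV₂ hx))
  have yA₁ : ∀ e ∈ E₁, A e ⊆ Y := fun e he => by
    rw [A₁ e he]; exact insert_subset (hE₁ he) yV₁
  have yA₂ : ∀ e ∈ E₂, A e ⊆ Y := fun e he => by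
    rw [A₂ e he]; exact insert_subset (yE₂ he) yV₂
  have minE : ∀ e ∈ E₁, ∀ A' ⊆ I, ∀ x ∈ A e ∪ A', e ≤ x := by
    intro e he A' hA' x hx
    rw [A₁ e he, mem_union, mem_insert] at hx
    rcases hx with (rfl | hx) | hx
    · exact le_rfl
    · exact (oV₁ e he x hx).le
    · exact (lE₁ e he x (sI (hA' hx))).le
  have maxE : ∀ e ∈ E₂, ∀ A' ⊆ I, ∀ x ∈ A e ∪ A', x ≤ e := by
    intro e he A' hA' x hx
    rw [A₂ e he, mem_union, mem_insert] at hx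
    rcases hx with (rfl | hx) | hx
    · exact le_rfl
    · exact (lE₂ x hx e he).le
    · exact (lI x (hA' hx) e (sE₂ he)).le
  have cmin₁ : ∀ e ∈ E₁, g ≤ #{y ∈ Y | e ≤ y} := fun e he => by
    have : g ≤ #I := by omega
    exact this.trans (card_le_card fun x hx =>
      mem_filter.2 ⟨yI hx, (lE₁ e he x (sI hx)).le⟩)
  have cmax₂ : ∀ e ∈ E₂, g ≤ #{y ∈ Y | y ≤ e} := fun e he => by
    have : g ≤ #I := by omega
    exact this.trans (card_le_card fun x hx =>
      mem_filter.2 ⟨yI hx, (lI x hx e (sE₂ he)).le⟩)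
  have cminj : g ≤ #{y ∈ Y | j ≤ y} := by
    rw [← cE₂]
    exact card_le_card fun x hx => mem_filter.2 ⟨yE₂ hx, (lI j hj x (sE₂ hx)).le⟩
  have cmaxj : g ≤ #{y ∈ Y | y ≤ j} := by
    rw [← cE₁]
    exact card_le_card fun x hx => mem_filter.2 ⟨hE₁ hx, (lE₁ x hx j (sI hj)).le⟩
  have hhalf : g ≤ #{x ∈ I | j ≤ x} ∨ g ≤ #{x ∈ I | x ≤ j} := by
    by_contra! hcon
    have hsub : I ⊆ {x ∈ I | j ≤ x} ∪ {x ∈ I | x ≤ j} := fun x hx => by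
      rw [mem_union, mem_filter, mem_filter]
      exact (le_total j x).imp (fun h => ⟨hx, h⟩) (fun h => ⟨hx, h⟩)
    have := (card_le_card hsub).trans (card_union_le _ _)
    omega
  rcases hhalf with hhalf | hhalf
  · obtain ⟨A', hjA', hA', cA'⟩ := exists_subsuperset_card_eq (s := {j})
      (t := {x ∈ I | j ≤ x}) (n := g) (by simpa using hj) (by rw [card_singleton]; exact hgpos) hhalf
    have hA'I : A' ⊆ I := hA'.trans (filter_subset _ _)
    have hjmin : ∀ x ∈ A', j ≤ x := fun x hx => (mem_filter.1 (hA' hx)).2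
    have hal := hst.alive s' hs' hthick a ha.le j A'
      (hmin A' (hA'I.trans yI) cA' j (hjA' (mem_singleton_self j)) hjmin)
    obtain ⟨n, ⟨⟨hn, ⟨y, T, hT⟩⟩, hnmin⟩, hnmax⟩ := (((hev.and hal).and nmin).and nmax).exists
    obtain ⟨e, he, r, S, hS, hadj, h₁, h₂⟩ := hn y hT.root_mem_block
    have hcross := cross n y r S a A' T h₁ h₂ hA'I hT
    have hT' := hT.mono (hs' n) subset_rfl
    have hdis := dis e he A' hA'I
    -- T has order a and root block j. For e in E₁ the orders agree and e is lowest. For e in E₂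
    -- only the smaller order can be raised: rooted at j, lowest of the union, if a ≤ b, and at e,
    -- highest, if b ≤ a.
    rcases mem_union.1 he with he | he
    · rw [m₁ e he] at hS
      obtain ⟨⟨S', hS'⟩, -⟩ := hS.join_le (hd n) hT' le_rfl le_rfl hdis hadj hcross
      exact hnmin _ (union_subset (yA₁ e he) (hA'I.trans yI)) e (minE e he A' hA'I)
        (cmin₁ e he) _ _ hS'
    · rw [m₂ e he] at hS
      rcases le_total a b with hab | hab
      · obtain ⟨-, ⟨S', hS'⟩⟩ := hS.join_le (hd n) hT' hab le_rfl hdis hadj hcross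
        refine hnmin _ (union_subset (yA₂ e he) (hA'I.trans yI)) j ?_ cminj _ _ hS'
        intro x hx
        rw [A₂ e he, mem_union, mem_insert] at hx
        rcases hx with (rfl | hx) | hx
        · exact (lI j hj x (sE₂ he)).le
        · exact (lI j hj x (hV₂ hx)).le
        · exact hjmin x hx
      · obtain ⟨⟨S', hS'⟩, -⟩ := hS.join_le (hd n) hT' le_rfl hab hdis hadj hcross
        exact hnmax _ (union_subset (yA₂ e he) (hA'I.trans yI)) e (maxE e he A' hA'I)
          (cmax₂ e he) _ _ hS'
  · obtain ⟨A', hjA', hA', cA'⟩ := exists_subsuperset_card_eq (s := {j})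
      (t := {x ∈ I | x ≤ j}) (n := g) (by simpa using hj) (by rw [card_singleton]; exact hgpos) hhalf
    have hA'I : A' ⊆ I := hA'.trans (filter_subset _ _)
    have hjmax : ∀ x ∈ A', x ≤ j := fun x hx => (mem_filter.1 (hA' hx)).2
    have hal := hst.alive s' hs' hthick b hb.le j A'
      (hmax A' (hA'I.trans yI) cA' j (hjA' (mem_singleton_self j)) hjmax)
    obtain ⟨n, ⟨⟨hn, ⟨y, T, hT⟩⟩, hnmin⟩, hnmax⟩ := (((hev.and hal).and nmin).and nmax).exists
    obtain ⟨e, he, r, S, hS, hadj, h₁, h₂⟩ := hn y hT.root_mem_block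
    have hcross := cross n y r S b A' T h₁ h₂ hA'I hT
    have hT' := hT.mono (hs' n) subset_rfl
    have hdis := dis e he A' hA'I
    rcases mem_union.1 he with he | he
    · rw [m₁ e he] at hS
      rcases le_total a b with hab | hab
      · obtain ⟨⟨S', hS'⟩, -⟩ := hS.join_le (hd n) hT' le_rfl hab hdis hadj hcross
        exact hnmin _ (union_subset (yA₁ e he) (hA'I.trans yI)) e (minE e he A' hA'I)
          (cmin₁ e he) _ _ hS'
      · obtain ⟨-, ⟨S', hS'⟩⟩ := hS.join_le (hd n) hT' hab le_rfl hdis hadj hcross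
        refine hnmax _ (union_subset (yA₁ e he) (hA'I.trans yI)) j ?_ cmaxj _ _ hS'
        intro x hx
        rw [A₁ e he, mem_union, mem_insert] at hx
        rcases hx with (rfl | hx) | hx
        · exact (lE₁ x he j (sI hj)).le
        · exact (lV₁ x hx j (hI hj)).le
        · exact hjmax x hx
    · rw [m₂ e he] at hS
      obtain ⟨⟨S', hS'⟩, -⟩ := hS.join_le (hd n) hT' le_rfl le_rfl hdis hadj hcross
      exact hnmax _ (union_subset (yA₂ e he) (hA'I.trans yI)) e (maxE e he A' hA'I)
        (cmax₂ e he) _ _ hS'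

end Asymptotic

/-! ### Assembling the dichotomy with Ramsey's theorem. -/

theorem Finset.card_insert_insert_union {ι : Type*} [LinearOrder ι] {E₁ E₂ : Finset ι} {t i : ι}
    (h₁ : ∀ x ∈ E₁, x < t) (h : t < i) (h₂ : ∀ x ∈ E₂, i < x) :
    #(insert t (insert i (E₁ ∪ E₂))) = #E₁ + #E₂ + 2 := by
  rw [card_insert_of_notMem, card_insert_of_notMem, card_union_of_disjoint]
  · exact Finset.disjoint_left.2 fun x hx hx' => lt_irrefl x (((h₁ x hx).trans h).trans (h₂ x hx'))
  · rw [mem_union]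
    rintro (hi | hi)
    · exact lt_asymm h (h₁ i hi)
    · exact lt_irrefl i (h₂ i hi)
  · rw [mem_insert, mem_union]
    rintro (hi | hi | hi)
    · exact h.ne hi
    · exact lt_irrefl t (h₁ t hi)
    · exact lt_asymm h (h₂ t hi)

theorem exists_lt_and_not_succ {P : ℕ → Prop} (h0 : P 0) {h : ℕ} (hh : ¬ P h) :
    ∃ a < h, P a ∧ ¬ P (a + 1) := by
  by_contra! hcon
  have : ∀ k ≤ h, P k := by
    intro k
    induction k with
    | zero => exact fun _ => h0
    | succ k ih => exact fun hk => hcon k (by omega) (ih (by omega))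
  exact hh (this h le_rfl)

namespace Asymptotic

universe u

/-- A long enough system of thick blocks in a coherent sequence of graphs contains rainbow
binomial trees of order `h`. -/
theorem exists_isPlacedCopy (h : ℕ) : ∃ N : ℕ, ∀ {V : ℕ → Type u} [∀ n, Fintype (V n)]
    {𝒰 : Ultrafilter ℕ} {W : ℕ → ℕ} {G : ∀ n, SimpleGraph (V n)}
    {s : ∀ n, Fin N → Finset (V n)}, IsCoherent 𝒰 W G →
    (∀ n, Pairwise fun k l => Disjoint (s n k) (s n l)) →
    (∀ i, IsThick 𝒰 W fun n => s n i) →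
    ∀ᶠ n in 𝒰, ∃ A i r S, (G n).IsPlacedCopy (s n) h A i r S := by
  obtain ⟨N₁, hN₁⟩ := exists_monochromatic_subset.{0}
    (κ := Set (Fin (h + 1)) × Set (Fin (h + 1))) (2 ^ h) (6 * 2 ^ h)
  obtain ⟨N, hN⟩ := exists_monochromatic_subset.{0} (κ := Prop × Prop) (2 * 2 ^ h + 2) N₁
  refine ⟨N, fun {V} _ {𝒰 W G s₁} hG hd₁ hthick => ?_⟩
  obtain ⟨s, hs, hst⟩ := exists_isStable (G := G) h hthick
  have hd : ∀ n, Pairwise fun k l => Disjoint (s n k) (s n l) := fun n k l hkl =>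
    (hd₁ n hkl).mono (hs n k) (hs n l)
  suffices hsuff : ∀ᶠ n in 𝒰, ∃ A i r S, (G n).IsPlacedCopy (s n) h A i r S by
    refine hsuff.mono fun n ⟨A, i, r, S, hS⟩ => ⟨A, i, r, S, hS.mono (hs n) subset_rfl⟩
  have hpow : 0 < 2 ^ h := by positivity
  set IsSplit : Finset (Fin N) → Finset (Fin N) → Fin N → Fin N → Prop := fun E₁ E₂ t i =>
    #E₁ = 2 ^ h ∧ #E₂ = 2 ^ h ∧ (∀ x ∈ E₁, x < t) ∧ t < i ∧ ∀ x ∈ E₂, i < x with hsplit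
  -- Quantifying over splits makes the colour depend on the set alone. By `huniq` every split of the
  -- set gives the same t, i and union, so a false colour excludes availability.
  obtain ⟨Y, -, hYc, col, hcol⟩ := hN (Fin N) (fun A =>
    (∀ E₁ E₂ t i, IsSplit E₁ E₂ t i → A = insert t (insert i (E₁ ∪ E₂)) →
        IsAvailable 𝒰 W G s i t (E₁ ∪ E₂),
      ∀ E₁ E₂ t i, IsSplit E₁ E₂ t i → A = insert t (insert i (E₁ ∪ E₂)) →
        IsAvailable 𝒰 W G s t i (E₁ ∪ E₂))) univ (by simp)
  obtain ⟨Y', hY', hYc', M, hM⟩ := hN₁ (Fin N) (fun A =>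
    ({m | ∀ i ∈ A, (∀ x ∈ A, i ≤ x) → IsAlive 𝒰 G s m i A},
      {m | ∀ i ∈ A, (∀ x ∈ A, x ≤ i) → IsAlive 𝒰 G s m i A})) Y hYc
  have hsub : ∀ {E₁ E₂ : Finset (Fin N)} {t i : Fin N}, E₁ ⊆ Y' → E₂ ⊆ Y' → t ∈ Y' → i ∈ Y' →
      insert t (insert i (E₁ ∪ E₂)) ⊆ Y := fun h₁ h₂ ht hi =>
    (insert_subset ht (insert_subset hi (union_subset h₁ h₂))).trans hY'
  have hcard : ∀ {E₁ E₂ : Finset (Fin N)} {t i : Fin N}, IsSplit E₁ E₂ t i →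
      #(insert t (insert i (E₁ ∪ E₂))) = 2 * 2 ^ h + 2 := fun hsp => by
    rw [card_insert_insert_union hsp.2.2.1 hsp.2.2.2.1 hsp.2.2.2.2, hsp.1, hsp.2.1]
    ring
  have huniq : ∀ {E₁ E₂ F₁ F₂ : Finset (Fin N)} {t i u j : Fin N}, IsSplit E₁ E₂ t i →
      IsSplit F₁ F₂ u j → insert t (insert i (E₁ ∪ E₂)) = insert u (insert j (F₁ ∪ F₂)) →
      t = u ∧ i = j ∧ E₁ ∪ E₂ = F₁ ∪ F₂ := fun h₁ h₂ heq =>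
    split_pair_unique h₁.2.2.1 h₁.2.2.2.1 h₁.2.2.2.2 h₂.2.2.1 h₂.2.2.2.1 h₂.2.2.2.2
      (h₁.1.trans h₂.1.symm) heq
  by_cases hleft : col.1
  · refine hst.exists_isPlacedCopy_of_isAvailable_left hd hG.width_pos (Y := Y') (by omega) ?_
    intro E₁ h₁ E₂ h₂ t ht i hi c₁ c₂ l₁ l l₂
    have hsp : IsSplit E₁ E₂ t i := ⟨c₁, c₂, l₁, l, l₂⟩
    rw [← hcol _ (hsub h₁ h₂ ht hi) (hcard hsp)] at hleft
    exact hleft _ _ _ _ hsp rfl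
  by_cases hright : col.2
  · refine hst.exists_isPlacedCopy_of_isAvailable_right hd hG.width_pos (Y := Y') (by omega) ?_
    intro E₁ h₁ E₂ h₂ t ht i hi c₁ c₂ l₁ l l₂
    have hsp : IsSplit E₁ E₂ t i := ⟨c₁, c₂, l₁, l, l₂⟩
    rw [← hcol _ (hsub h₁ h₂ ht hi) (hcard hsp)] at hright
    exact hright _ _ _ _ hsp rfl
  obtain ⟨A, hAY, hAc⟩ := exists_subset_card_eq (s := Y') (n := 2 ^ h) (by omega)
  have hAne : A.Nonempty := card_pos.1 (by omega)
  have halive₀ : ∀ (A : Finset (Fin N)), ∀ i ∈ A, IsAlive 𝒰 G s 0 i A := by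
    intro A i hi
    refine ((hst.thick i).eventually_nonempty hG.width_pos).mono fun n ⟨r, hr⟩ => ?_
    exact ⟨r, {r}, .zero hr hi⟩
  set Pmin : ℕ → Prop := fun m => ∀ A ⊆ Y', #A = 2 ^ h → ∀ i ∈ A, (∀ x ∈ A, i ≤ x) →
    IsAlive 𝒰 G s m i A with hPmin
  set Pmax : ℕ → Prop := fun m => ∀ A ⊆ Y', #A = 2 ^ h → ∀ i ∈ A, (∀ x ∈ A, x ≤ i) →
    IsAlive 𝒰 G s m i A with hPmax
  have hdead₁ : ∀ m ≤ h, ¬ Pmin m → ∀ A ⊆ Y', #A = 2 ^ h → ∀ i ∈ A, (∀ x ∈ A, i ≤ x) →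
      ¬ IsAlive 𝒰 G s m i A := by
    intro m hm hP A hA hAc i hi hmin hal
    refine hP fun A' hA' hAc' => ?_
    have hmem : (⟨m, by omega⟩ : Fin (h + 1)) ∈ M.1 := by
      rw [← (Prod.ext_iff.1 (hM A hA hAc)).1]
      intro j hj hjmin
      rwa [le_antisymm (hjmin i hi) (hmin j hj)]
    rw [← (Prod.ext_iff.1 (hM A' hA' hAc')).1] at hmem
    exact hmem
  have hdead₂ : ∀ m ≤ h, ¬ Pmax m → ∀ A ⊆ Y', #A = 2 ^ h → ∀ i ∈ A, (∀ x ∈ A, x ≤ i) →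
      ¬ IsAlive 𝒰 G s m i A := by
    intro m hm hP A hA hAc i hi hmax hal
    refine hP fun A' hA' hAc' => ?_
    have hmem : (⟨m, by omega⟩ : Fin (h + 1)) ∈ M.2 := by
      rw [← (Prod.ext_iff.1 (hM A hA hAc)).2]
      intro j hj hjmax
      rwa [le_antisymm (hmax j hj) (hjmax i hi)]
    rw [← (Prod.ext_iff.1 (hM A' hA' hAc')).2] at hmem
    exact hmem
  by_cases hmin : Pmin h
  · exact Filter.Eventually.mono
      (hmin A hAY hAc _ (A.min'_mem hAne) fun x hx => A.min'_le x hx) fun n ⟨r, S, hS⟩ => ⟨_, _, r, S, hS⟩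
  by_cases hmax : Pmax h
  · exact Filter.Eventually.mono
      (hmax A hAY hAc _ (A.max'_mem hAne) fun x hx => A.le_max' x hx) fun n ⟨r, S, hS⟩ => ⟨_, _, r, S, hS⟩
  obtain ⟨a, ha, hPa, hPa'⟩ :=
    exists_lt_and_not_succ (P := Pmin) (fun A _ _ i hi _ => halive₀ A i hi) hmin
  obtain ⟨b, hb, hPb, hPb'⟩ :=
    exists_lt_and_not_succ (P := Pmax) (fun A _ _ i hi _ => halive₀ A i hi) hmax
  refine (hst.false_of_not_isAvailable hG hd hYc' ?_ ?_ ha hb hPa hPb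
    (hdead₁ _ ha hPa') (hdead₂ _ hb hPb')).elim
  · intro E₁ h₁ E₂ h₂ t ht i hi c₁ c₂ l₁ l l₂ hav
    have hsp : IsSplit E₁ E₂ t i := ⟨c₁, c₂, l₁, l, l₂⟩
    rw [← hcol _ (hsub h₁ h₂ ht hi) (hcard hsp)] at hleft
    refine hleft fun F₁ F₂ u j hsp' heq => ?_
    obtain ⟨rfl, rfl, hEF⟩ := huniq hsp hsp' heq
    rwa [← hEF]
  · intro E₁ h₁ E₂ h₂ t ht i hi c₁ c₂ l₁ l l₂ hav
    have hsp : IsSplit E₁ E₂ t i := ⟨c₁, c₂, l₁, l, l₂⟩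
    rw [← hcol _ (hsub h₁ h₂ ht hi) (hcard hsp)] at hright
    refine hright fun F₁ F₂ u j hsp' heq => ?_
    obtain ⟨rfl, rfl, hEF⟩ := huniq hsp hsp' heq
    rwa [← hEF]

end Asymptotic

/-! ### Back to blockades and single graphs. -/

namespace Blockade

/-- The first `N` blocks of a blockade (in some order), or empty sets if there are fewer. -/
noncomputable def blocks {V : Type*} (B : Blockade V) (N : ℕ) (k : Fin N) : Finset V :=
  if h : N ≤ B.length then B.block (B.index.equivFin.symm (Fin.castLE h k)) else ∅

variable {V : Type*} {B : Blockade V} {N : ℕ}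

theorem pairwise_disjoint_blocks : Pairwise fun k l => Disjoint (B.blocks N k) (B.blocks N l) := by
  intro k l hkl
  by_cases h : N ≤ B.length
  · simp only [blocks, dif_pos h]
    refine B.disjoint _ _ fun he => hkl ?_
    exact Fin.castLE_injective h (B.index.equivFin.symm.injective he)
  · simp [blocks, h]

theorem width_le_card_blocks (h : N ≤ B.length) (k : Fin N) : B.width ≤ #(B.blocks N k) := by
  simp only [blocks, dif_pos h]
  exact B.width_le _

theorem exists_isRainbow_of_isPlacedCopy {U : Type*} [Fintype U] {T : SimpleGraph U}
    (hT : T.IsTree) {G : SimpleGraph V} {A : Finset (Fin N)} {i : Fin N} {r : V} {S : Finset V}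
    (hS : G.IsPlacedCopy (B.blocks N) (Fintype.card U) A i r S) :
    ∃ S : Set V, B.IsRainbow S ∧ Nonempty (T ≃g G.induce S) := by
  obtain ⟨u⟩ := hT.1.nonempty
  obtain ⟨hS, p, hinj, hp, -⟩ := hS
  obtain ⟨f, hf, hfS, -, hadj⟩ := (hT.rootedTreeOn_univ u).exists_embedding hS
    (by rw [card_univ]; omega)
  have hf' : Function.Injective f := fun x y hxy => hf (mem_coe.2 (mem_univ x))
    (mem_coe.2 (mem_univ y)) hxy
  -- For a shorter blockade all `blocks` are empty and could not contain the copy.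
  have hlen : N ≤ B.length := by
    by_contra h
    have := (hp (f u) (hfS u (mem_univ u))).2
    simp [blocks, h] at this
  have hblock : ∀ x, f x ∈ B.block (B.index.equivFin.symm (Fin.castLE hlen (p (f x)))) := by
    intro x
    have := (hp (f x) (hfS x (mem_univ x))).2
    rwa [blocks, dif_pos hlen] at this
  have hindex : ∀ x j, f x ∈ B.block j → B.index.equivFin.symm (Fin.castLE hlen (p (f x))) = j := by
    intro x j hj
    by_contra hne
    exact Finset.disjoint_left.1 (B.disjoint _ _ hne) (hblock x) hj
  refine ⟨Set.range f, ⟨?_, ?_⟩, ⟨⟨Equiv.ofInjective f hf', ?_⟩⟩⟩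
  · rintro _ ⟨x, rfl⟩
    exact ⟨_, hblock x⟩
  · rintro j _ ⟨x, rfl⟩ _ ⟨y, rfl⟩ hx hy
    have h := (hindex x j hx).trans (hindex y j hy).symm
    exact hinj (hfS x (mem_univ x)) (hfS y (mem_univ y))
      (Fin.castLE_injective hlen (B.index.equivFin.symm.injective h))
  · intro x y
    exact hadj x (mem_univ x) y (mem_univ y)

end Blockade

namespace Asymptotic

universe u

/-- The coherence threshold ε|G| equals W / (n + 1), which is eventually below c W for every c > 0.
-/
theorem isCoherent_of_forall_isCoherent {V : ℕ → Type u} [∀ n, Fintype (V n)]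
    {G : ∀ n, SimpleGraph (V n)} [∀ n, DecidableRel (G n).Adj] {W : ℕ → ℕ}
    (hG : ∀ n, (G n).IsCoherent ((W n : ℝ) / (((n : ℝ) + 1) * (Fintype.card (V n) : ℝ))))
    {𝒰 : Ultrafilter ℕ} (h𝒰 : (𝒰 : Filter ℕ) ≤ Filter.atTop) : IsCoherent 𝒰 W G := by
  have hcard : ∀ n, (W n : ℝ) / (((n : ℝ) + 1) * (Fintype.card (V n) : ℝ)) *
      Fintype.card (V n) = W n / ((n : ℝ) + 1) := by
    intro n
    have h₁ : (0 : ℝ) < Fintype.card (V n) := by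
      exact_mod_cast zero_lt_one.trans (hG n).one_lt_card
    have h₂ : (0 : ℝ) < (n : ℝ) + 1 := by positivity
    field_simp
  have hsmall : ∀ c : ℝ, 0 < c → ∀ᶠ n in 𝒰, (W n : ℝ) / ((n : ℝ) + 1) ≤ c * W n := by
    intro c hc
    have h₁ := (tendsto_one_div_add_atTop_nhds_zero_nat (𝕜 := ℝ)).eventually_le_const hc
    refine (h₁.filter_mono h𝒰).mono fun n hn => ?_
    have := mul_le_mul_of_nonneg_right hn (Nat.cast_nonneg (α := ℝ) (W n))
    rwa [one_div_mul_eq_div] at this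
  refine ⟨Filter.Eventually.of_forall fun n => ?_, fun c hc => ?_, fun A B hA hB => ?_⟩
  · rcases Nat.eq_zero_or_pos (W n) with h | h
    · have := (hG n).pos
      rw [h] at this
      simp at this
    · exact h
  · refine (hsmall c hc).mono fun n hn v => ?_
    have h₁ := (hG n).degree_lt v
    rw [hcard n, ← SimpleGraph.card_neighborFinset_eq_degree,
      SimpleGraph.neighborFinset_eq_filter] at h₁
    refine le_trans (le_of_eq ?_) (h₁.le.trans hn)
    congr!
  · obtain ⟨c₁, hc₁, hA⟩ := hA
    obtain ⟨c₂, hc₂, hB⟩ := hB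
    filter_upwards [hA, hB, hsmall c₁ hc₁, hsmall c₂ hc₂] with n h₁ h₂ h₃ h₄ hdis
    by_contra! hcon
    refine (hG n).not_anticomplete ⟨A n, B n, hdis, hcon, ?_, ?_⟩
    · rw [hcard n]; exact h₃.trans h₁
    · rw [hcard n]; exact h₄.trans h₂

end Asymptotic

theorem mainTheorem2 {U : Type*} [Finite U] (T : SimpleGraph U) (hT : T.IsTree) :
    ∃ (d : ℝ) (K : ℕ), 0 < d ∧
      ∀ (V : Type*) [Fintype V] (G : SimpleGraph V) [DecidableRel G.Adj] (B : Blockade V),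
        K ≤ B.length →
        G.IsCoherent ((B.width : ℝ) / (d * (Fintype.card V : ℝ))) →
          ∃ S : Set V, B.IsRainbow S ∧ Nonempty (T ≃g G.induce S) := by
  have := Fintype.ofFinite U
  obtain ⟨N, hN⟩ := Asymptotic.exists_isPlacedCopy (Fintype.card U)
  by_contra hcon
  have hbad : ∀ n : ℕ, ∃ (V : Type _) (_ : Fintype V) (G : SimpleGraph V)
      (_ : DecidableRel G.Adj) (B : Blockade V), n ≤ B.length ∧
      G.IsCoherent ((B.width : ℝ) / (((n : ℝ) + 1) * (Fintype.card V : ℝ))) ∧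
      ¬ ∃ S : Set V, B.IsRainbow S ∧ Nonempty (T ≃g G.induce S) := by
    intro n
    by_contra hn
    exact hcon ⟨(n : ℝ) + 1, n, by positivity, fun V _ G _ B h₁ h₂ =>
      by_contra fun h₃ => hn ⟨V, _, G, _, B, h₁, h₂, h₃⟩⟩
  choose V hV G hdec B hlen hcoh hno using hbad
  have hle : ((Filter.hyperfilter ℕ : Ultrafilter ℕ) : Filter ℕ) ≤ Filter.atTop := by
    rw [← Nat.cofinite_eq_atTop]
    exact Filter.hyperfilter_le_cofinite
  have hG := Asymptotic.isCoherent_of_forall_isCoherent hcoh hle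
  obtain ⟨n, A, i, r, S, hS⟩ := (hN (s := fun n => (B n).blocks N) hG
    (fun n => Blockade.pairwise_disjoint_blocks) (fun i => ⟨1, one_pos, by
      refine ((Filter.eventually_ge_atTop N).filter_mono hle).mono fun n hn => ?_
      rw [one_mul]
      exact_mod_cast Blockade.width_le_card_blocks (hn.trans (hlen n)) i⟩)).exists
  exact hno n (Blockade.exists_isRainbow_of_isPlacedCopy hT hS)
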